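/- Let $q\ge 1$, $p\ge 0$ and $n>p+q+1$ be integers, and let $X\in\mathbb R^{n\times p}$ be a fixed matrix of rank $p$ with rows $x_1^\top,\dots,x_n^\top$. Consider the multivariate linear regression model in which $y_1,\dots,y_n$ are independent with $y_i\sim \mathrm N_q(B^\top x_i,\Sigma)$, where $B\in\mathbb R^{p\times q}$ and the positive definite matrix $\Sigma\in\mathbb R^{q\times q}$ are both unknown. Let $Y=(y_1,\dots,y_n)^\top$, let $p(Y\mid B,\Sigma)$ be its density, and let $\mathrm E_{B,\Sigma}$ be the expectation under it. Put $$\hat B=(X^\top X)^{-1}X^\top Y,\qquad \hat\Sigma=\tfrac1n (Y-X\hat B)^\top(Y-X\hat B),\qquad k=pq+\tfrac{q(q+1)}2,$$ $$d=d((B,\Sigma),(\hat B,\hat\Sigma))=-2\int p(\widetilde Y\mid B,\Sigma)\log p(\widetilde Y\mid \hat B,\hat\Sigma)\,d\widetilde Y,$$ $$\mathrm{AIC}=-2\log p(Y\mid\hat B,\hat\Sigma)+2k,\qquad \mathrm{AICc}=-2\log p(Y\mid\hat B,\hat\Sigma)+\frac{2n}{n-p-q-1}\,k ,$$ where $-2\log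 p(Y\mid\hat B,\hat\Sigma)=nq\log(2\pi)+n\log\det\hat\Sigma+nq$ almost surely. A measurable function $\lambda_1(Y)$ is said to dominate $\lambda_2(Y)$ as an estimator of the Kullback--Leibler discrepancy $d$ if $\mathrm E_{B,\Sigma}[(\lambda_1-d)^2]\le \mathrm E_{B,\Sigma}[(\lambda_2-d)^2]$ for all $(B,\Sigma)$, with strict inequality for at least one $(B,\Sigma)$; an estimator is inadmissible if some estimator dominates it. Then: 1. AICc and AIC differ by a constant: $\mathrm{AICc}-\mathrm{AIC}=\dfrac{2(p+q+1)}{n-p-q-1}\,k$ for every $Y$. 2. AICc is exactly unbiased: for all $(B,\Sigma)$, AICc and $d$ are integrable and $\mathrm E_{B,\Sigma}[\mathrm{AICc}]=\mathrm E_{B,\Sigma}[d]$. 3. For all $(B,\Sigma)$, $\mathrm E_{B,\Sigma}[(\mathrm{AICc}-d)^2]\le\mathrm E_{B,\Sigma}[(\mathrm{AIC}-d)^2]$ in $[0,\infty]$. 4. If $n>p+q+3$, then for all $(B,\Sigma)$ both mean squared errors are finite and $$\mathrm E_{B,\Sigma}[(\mathrm{AIC}-d)^2]-\mathrm E_{B,\Sigma}[(\mathrm{AICc}-d)^2]=\bigl(\mathrm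 E_{B,\Sigma}[\mathrm{AIC}]-\mathrm E_{B,\Sigma}[d]\bigr)^2 ;$$ moreover AICc dominates AIC, and AIC is inadmissible, as an estimator of the Kullback--Leibler discrepancy $d$. -/

import Mathlib

open MeasureTheory ProbabilityTheory
open scoped ENNReal Matrix

noncomputable section

/-! ### Loss estimation: comparing estimators of a random loss by mean squared error -/

namespace LossEstimation

variable {Θ 𝓨 : Type*} [MeasurableSpace 𝓨]

/-- Mean squared error `E_θ[(lam(Y) - L(θ, Y))²] ∈ [0, ∞]` of the loss estimator `lam`, where
`P θ` is the law of the observation `Y` and `L θ Y` is the loss to be estimated. -/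
def mse (P : Θ → Measure 𝓨) (L : Θ → 𝓨 → ℝ) (lam : 𝓨 → ℝ) (θ : Θ) : ℝ≥0∞ :=
  ∫⁻ y, ENNReal.ofReal ((lam y - L θ y) ^ 2) ∂(P θ)

/-- `lam₁` dominates `lam₂` as an estimator of the loss `L`. -/
def Dominates (P : Θ → Measure 𝓨) (L : Θ → 𝓨 → ℝ) (lam₁ lam₂ : 𝓨 → ℝ) : Prop :=
  (∀ θ, mse P L lam₁ θ ≤ mse P L lam₂ θ) ∧ ∃ θ, mse P L lam₁ θ < mse P L lam₂ θ

/-- A loss estimator is admissible if no (measurable) loss estimator dominates it. -/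
def Admissible (P : Θ → Measure 𝓨) (L : Θ → 𝓨 → ℝ) (lam : 𝓨 → ℝ) : Prop :=
  ¬ ∃ lam' : 𝓨 → ℝ, Measurable lam' ∧ Dominates P L lam' lam

end LossEstimation

/-! ### Multivariate linear regression with unknown covariance -/

namespace MVRegression

/-- The observations `(y₁, …, yₙ)`, each in `ℝ^q`. -/
abbrev Sample (n q : ℕ) : Type := Fin n → EuclideanSpace ℝ (Fin q)

/-- The `n × q` matrix `Y` whose rows are `y₁, …, yₙ`. -/
def dataMatrix {n q : ℕ} (Y : Sample n q) : Matrix (Fin n) (Fin q) ℝ :=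
  Matrix.of fun i j => Y i j

/-- The unknown parameter `(B, Σ)`: a `p × q` matrix and a positive definite `q × q` matrix. -/
abbrev Param (p q : ℕ) : Type :=
  Matrix (Fin p) (Fin q) ℝ × {S : Matrix (Fin q) (Fin q) ℝ // S.PosDef}

variable {n p q : ℕ}

/-- The mean `Bᵀ xᵢ` of the `i`-th observation, where `xᵢ` is the `i`-th row of `X`. -/
def rowMean (X : Matrix (Fin n) (Fin p) ℝ) (B : Matrix (Fin p) (Fin q) ℝ) (i : Fin n) :
    EuclideanSpace ℝ (Fin q) :=
  WithLp.toLp 2 (Bᵀ *ᵥ X i)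

/-- The law of the sample under `(B, Σ)`: the `yᵢ ~ N_q(Bᵀ xᵢ, Σ)` are independent. -/
def law (X : Matrix (Fin n) (Fin p) ℝ) (θ : Param p q) : Measure (Sample n q) :=
  Measure.pi fun i => multivariateGaussian (rowMean X θ.1 i) θ.2.1

/-- The Lebesgue density of `N_q(μ, S)` at `y`, for positive definite `S`. -/
def gaussianDensity (μ : EuclideanSpace ℝ (Fin q)) (S : Matrix (Fin q) (Fin q) ℝ)
    (y : EuclideanSpace ℝ (Fin q)) : ℝ :=
  (2 * Real.pi) ^ (-(q : ℝ) / 2) * S.det ^ (-(1 : ℝ) / 2) *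
    Real.exp (-(1 / 2) * ((y - μ).ofLp ⬝ᵥ (S⁻¹ *ᵥ (y - μ).ofLp)))

/-- The density `p(Y ∣ B, S)` of the sample. -/
def density (X : Matrix (Fin n) (Fin p) ℝ) (B : Matrix (Fin p) (Fin q) ℝ)
    (S : Matrix (Fin q) (Fin q) ℝ) (Y : Sample n q) : ℝ :=
  ∏ i, gaussianDensity (rowMean X B i) S (Y i)

/-- The maximum likelihood estimate `B̂ = (XᵀX)⁻¹ Xᵀ Y`. -/
def Bhat (X : Matrix (Fin n) (Fin p) ℝ) (Y : Sample n q) : Matrix (Fin p) (Fin q) ℝ :=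
  (Xᵀ * X)⁻¹ * Xᵀ * dataMatrix Y

/-- The maximum likelihood estimate `Σ̂ = (Y - X B̂)ᵀ (Y - X B̂) / n`. -/
def Sigmahat (X : Matrix (Fin n) (Fin p) ℝ) (Y : Sample n q) : Matrix (Fin q) (Fin q) ℝ :=
  (n : ℝ)⁻¹ • ((dataMatrix Y - X * Bhat X Y)ᵀ * (dataMatrix Y - X * Bhat X Y))

/-- The Kullback--Leibler discrepancy
`d((B, Σ), (B̂, Σ̂)) = -2 ∫ p(Y' ∣ B, Σ) log p(Y' ∣ B̂, Σ̂) dY'` of the plug-in predictive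
distribution (`p(Y' ∣ B, Σ) dY'` is the law of a new sample), as a function of the parameter `θ = (B, Σ)` and of the observed sample `Y`. -/
def klDiscrepancy (X : Matrix (Fin n) (Fin p) ℝ) (θ : Param p q) (Y : Sample n q) : ℝ :=
  -2 * ∫ Y', Real.log (density X (Bhat X Y) (Sigmahat X Y) Y') ∂(law X θ)

/-- The number `pq + q(q+1)/2` of free parameters of the model. -/
def numParams (p q : ℕ) : ℝ := (p : ℝ) * q + (q : ℝ) * (q + 1) / 2

/-- `AIC = -2 log p(Y ∣ B̂, Σ̂) + 2 (pq + q(q+1)/2)`. -/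
def AIC (X : Matrix (Fin n) (Fin p) ℝ) (Y : Sample n q) : ℝ :=
  -2 * Real.log (density X (Bhat X Y) (Sigmahat X Y) Y) + 2 * numParams p q

/-- `AICc = -2 log p(Y ∣ B̂, Σ̂) + 2n/(n-p-q-1) (pq + q(q+1)/2)`. -/
def AICc (X : Matrix (Fin n) (Fin p) ℝ) (Y : Sample n q) : ℝ :=
  -2 * Real.log (density X (Bhat X Y) (Sigmahat X Y) Y) +
    2 * (n : ℝ) / ((n : ℝ) - p - q - 1) * numParams p q

end MVRegression

end

noncomputable section

/-! ### Inverse moments of chi-square variables and projections of Gaussian vectors. -/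

namespace ProbabilityTheory

variable {E : Type*} [NormedAddCommGroup E] [InnerProductSpace ℝ E] [FiniteDimensional ℝ E]
  [MeasurableSpace E] [BorelSpace E]

/-! The error AICc − d is a pivot: its law is free of (B, Σ). The standardized data Z = (Y −
XB)Σ^(-1/2) have independent standard normal entries, so the columns of Z project to independent
Gaussian families on the column space of X (dimension p) and on its complement (dimension n − p).
Let V and W be their Gram matrices. Then nΣ̂ = Σ^(1/2) W Σ^(1/2), and the fitted error XB − XB̂ has
Gram matrix Σ^(1/2) V Σ^(1/2). Almost surely, d is the sum of nq log 2π + n log det Σ̂ and the trace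
loss n² tr W⁻¹ + n tr(W⁻¹V) (`klDiscrepancy_eq`). The first summand also occurs in AICc, so it
cancels and AICc − d is a constant minus the trace loss (`AICc_sub_klDiscrepancy_ae_eq`).

The mean of the trace loss rests on W⁻¹. A diagonal entry of W⁻¹ is the inverse squared length of
the residual of one vector on the others, hence an inverse chi-square with n − p − q + 1 degrees of
freedom (`lintegral_inv_gram_apply_self`). Its mean is 1/m with m = n − p − q − 1, and its square is
integrable once n > p + q + 3. As E V = pI and V is independent of W, the trace loss has mean nq(n +
p)/m = nq + 2nk/m, exactly the constant in AICc (`integral_traceLoss`).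

AIC − d is therefore a centred variable minus a constant c > 0. Such a shift raises the mean squared
error by c² when second moments are finite, and never lowers it otherwise. -/

theorem integral_exp_neg_mul_sq_gaussianReal {t : ℝ} (ht : 0 ≤ t) :
    ∫ x, Real.exp (-(t / 2) * x ^ 2) ∂(gaussianReal 0 1) = (1 + t) ^ (-(1 / 2) : ℝ) := by
  rw [integral_gaussianReal_eq_integral_smul one_ne_zero]
  have h : ∀ x : ℝ, gaussianPDFReal 0 1 x • Real.exp (-(t / 2) * x ^ 2) =
      (√(2 * Real.pi))⁻¹ * Real.exp (-((1 + t) / 2) * x ^ 2) := by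
    intro x
    simp only [gaussianPDFReal_def, smul_eq_mul, NNReal.coe_one, sub_zero, mul_one]
    rw [mul_assoc, ← Real.exp_add]
    congr 2
    ring
  simp_rw [h]
  rw [integral_const_mul, integral_gaussian, Real.rpow_neg (by linarith), ← Real.sqrt_eq_rpow,
    ← Real.sqrt_inv, ← Real.sqrt_inv, ← Real.sqrt_mul (by positivity)]
  congr 1
  have := Real.pi_pos
  field_simp

omit [FiniteDimensional ℝ E] [MeasurableSpace E] [BorelSpace E] in
theorem norm_sq_sum_smul_orthonormalBasis {ι : Type*} [Fintype ι] (b : OrthonormalBasis ι ℝ E)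
    (x : ι → ℝ) : ‖∑ i, x i • b i‖ ^ 2 = ∑ i, x i ^ 2 := by
  rw [← real_inner_self_eq_norm_sq, b.orthonormal.inner_sum]
  simp [sq]

/-- Orthonormal coordinates are independent, so the Laplace transform of the chi-square law is a
power of the one-dimensional one. -/
theorem integral_exp_neg_mul_norm_sq_stdGaussian {t : ℝ} (ht : 0 ≤ t) :
    ∫ x, Real.exp (-(t / 2) * ‖x‖ ^ 2) ∂(stdGaussian E) =
      (1 + t) ^ (-((Module.finrank ℝ E : ℝ) / 2)) := by
  rw [stdGaussian, integral_map (Measurable.aemeasurable (by fun_prop))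
    (Measurable.aestronglyMeasurable (by fun_prop))]
  simp_rw [norm_sq_sum_smul_orthonormalBasis, Finset.mul_sum, Real.exp_sum]
  rw [integral_fintype_prod_eq_prod (f := fun _ x ↦ Real.exp (-(t / 2) * x ^ 2))]
  simp_rw [integral_exp_neg_mul_sq_gaussianReal ht]
  rw [Finset.prod_const, Finset.card_univ, Fintype.card_fin, ← Real.rpow_natCast,
    ← Real.rpow_mul (by linarith)]
  congr 1
  ring

theorem lintegral_exp_neg_mul_norm_sq_stdGaussian {t : ℝ} (ht : 0 ≤ t) :
    ∫⁻ x, ENNReal.ofReal (Real.exp (-(t / 2) * ‖x‖ ^ 2)) ∂(stdGaussian E) =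
      ENNReal.ofReal ((1 + t) ^ (-((Module.finrank ℝ E : ℝ) / 2))) := by
  rw [← integral_exp_neg_mul_norm_sq_stdGaussian ht, ofReal_integral_eq_lintegral_ofReal]
  · refine Integrable.of_bound (Measurable.aestronglyMeasurable (by fun_prop)) 1 (.of_forall ?_)
    intro x
    rw [Real.norm_eq_abs, Real.abs_exp, Real.exp_le_one_iff]
    have : 0 ≤ t / 2 * ‖x‖ ^ 2 := by positivity
    linarith
  · exact .of_forall fun x ↦ (Real.exp_pos _).le

/-- A proper subspace is orthogonal to some v ≠ 0, and ⟨v, x⟩ is a nondegenerate Gaussian, which has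
no atom at 0. -/
theorem ae_notMem_stdGaussian {V : Submodule ℝ E} (hV : V ≠ ⊤) :
    ∀ᵐ x ∂(stdGaussian E), x ∉ V := by
  obtain ⟨v, hv, hv0⟩ := Submodule.exists_mem_ne_zero_of_ne_bot
    (mt (Submodule.orthogonal_eq_bot_iff (K := V)).1 hV)
  have hmap := IsGaussian.map_eq_gaussianReal (μ := stdGaussian E) (innerSL ℝ v)
  have hne : Var[innerSL ℝ v; stdGaussian E].toNNReal ≠ 0 := by
    rw [variance_dual_stdGaussian]
    simp [hv0]
  have := nullSingletonClass_gaussianReal (μ := ∫ x, innerSL ℝ v x ∂(stdGaussian E)) hne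
  have h0 : ∀ᵐ y ∂((stdGaussian E).map (innerSL ℝ v)), y ≠ 0 := by
    rw [hmap, ae_iff]
    simp only [ne_eq, not_not, Set.ofPred_eq_eq_singleton]
    exact measure_singleton 0
  filter_upwards [ae_of_ae_map (innerSL ℝ v).measurable.aemeasurable h0] with x hx hxV
  exact hx (by simpa using (Submodule.mem_orthogonal' _ _).1 hv x hxV)

theorem integrable_of_integral_ne_zero {α : Type*} [MeasurableSpace α] {μ : Measure α}
    {f : α → ℝ} (h : ∫ x, f x ∂μ ≠ 0) : Integrable f μ := by
  by_contra hf
  exact h (integral_undef hf)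

/-- The Gamma integral writes a negative power of s as a mixture of exponentials, so inverse moments
follow from the Laplace transform by Tonelli. -/
theorem lintegral_rpow_mul_exp_neg {a s : ℝ} (ha : 0 < a) (hs : 0 < s) :
    ∫⁻ t in Set.Ioi (0 : ℝ), ENNReal.ofReal (t ^ (a - 1) * Real.exp (-(t / 2) * s)) =
      ENNReal.ofReal ((2 / s) ^ a * Real.Gamma a) := by
  have h := Real.integral_rpow_mul_exp_neg_mul_Ioi ha (half_pos hs)
  have h2 : (1 / (s / 2)) ^ a = (2 / s) ^ a := by congr 1; field_simp
  rw [h2] at h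
  have h3 : ∀ t : ℝ, -(t / 2) * s = -(s / 2 * t) := fun t ↦ by ring
  simp_rw [h3]
  rw [← h, ofReal_integral_eq_lintegral_ofReal]
  · refine integrable_of_integral_ne_zero ?_
    rw [h]
    exact (mul_pos (Real.rpow_pos_of_pos (by positivity) _) (Real.Gamma_pos_of_pos ha)).ne'
  · filter_upwards [ae_restrict_mem measurableSet_Ioi] with t ht
    exact mul_nonneg (Real.rpow_nonneg (le_of_lt ht) _) (Real.exp_pos _).le

/-- Negative moments of the chi-square distribution, as a one-dimensional integral. -/
theorem lintegral_inv_norm_sq_rpow_stdGaussian {a : ℝ} (ha : 0 < a)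
    (hE : 0 < Module.finrank ℝ E) :
    ∫⁻ x, ENNReal.ofReal ((2 / ‖x‖ ^ 2) ^ a * Real.Gamma a) ∂(stdGaussian E) =
      ∫⁻ t : ℝ in Set.Ioi 0, ENNReal.ofReal
        (t ^ (a - 1) * (1 + t) ^ (-((Module.finrank ℝ E : ℝ) / 2))) := by
  have hne : (⊥ : Submodule ℝ E) ≠ ⊤ := by
    have := Module.finrank_pos_iff.1 hE
    exact bot_ne_top
  have h1 : ∫⁻ x, ENNReal.ofReal ((2 / ‖x‖ ^ 2) ^ a * Real.Gamma a) ∂(stdGaussian E) =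
      ∫⁻ x, ∫⁻ t : ℝ in Set.Ioi 0, ENNReal.ofReal
        (t ^ (a - 1) * Real.exp (-(t / 2) * ‖x‖ ^ 2)) ∂(volume) ∂(stdGaussian E) := by
    refine lintegral_congr_ae ?_
    filter_upwards [ae_notMem_stdGaussian hne] with x hx
    have : x ≠ 0 := by simpa using hx
    rw [lintegral_rpow_mul_exp_neg ha (by positivity)]
  rw [h1, lintegral_lintegral_swap (Measurable.aemeasurable (by fun_prop))]
  refine setLIntegral_congr_fun measurableSet_Ioi fun t ht ↦ ?_
  have h0 : 0 ≤ t := le_of_lt ht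
  simp_rw [ENNReal.ofReal_mul (Real.rpow_nonneg h0 (a - 1))]
  rw [lintegral_const_mul _ (by fun_prop), lintegral_exp_neg_mul_norm_sq_stdGaussian h0]

theorem integrableOn_one_add_rpow {a : ℝ} (ha : a < -1) :
    IntegrableOn (fun t : ℝ ↦ (1 + t) ^ a) (Set.Ioi 0) := by
  simpa [add_comm] using integrableOn_add_rpow_Ioi_of_lt (c := 0) (m := 1) ha (by norm_num)

theorem integral_one_add_rpow {a : ℝ} (ha : a < -1) :
    ∫ t in Set.Ioi (0 : ℝ), (1 + t) ^ a = (-(a + 1))⁻¹ := by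
  have h := (measurePreserving_add_right (volume : Measure ℝ) 1).setIntegral_preimage_emb
    (measurableEmbedding_addRight 1) (fun t ↦ t ^ a) (Set.Ioi 1)
  rw [integral_Ioi_rpow_of_lt ha one_pos] at h
  simp only [Set.preimage_add_const_Ioi, sub_self, Real.one_rpow] at h
  simp_rw [add_comm (1 : ℝ)]
  rw [h, neg_div, one_div, inv_neg]

theorem lintegral_inv_norm_sq_stdGaussian (hE : 2 < Module.finrank ℝ E) :
    ∫⁻ x, ENNReal.ofReal ((‖x‖ ^ 2)⁻¹) ∂(stdGaussian E) =
      ENNReal.ofReal (((Module.finrank ℝ E : ℝ) - 2)⁻¹) := by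
  have h := lintegral_inv_norm_sq_rpow_stdGaussian (E := E) one_pos (by omega)
  have hr : (2 : ℝ) < Module.finrank ℝ E := by exact_mod_cast hE
  have ha : -((Module.finrank ℝ E : ℝ) / 2) < -1 := by linarith
  simp only [Real.rpow_one, Real.Gamma_one, mul_one, sub_self, Real.rpow_zero, one_mul] at h
  rw [← ofReal_integral_eq_lintegral_ofReal (integrableOn_one_add_rpow ha),
    integral_one_add_rpow ha] at h
  · have h2 : ∀ x : E, ENNReal.ofReal ((‖x‖ ^ 2)⁻¹) =
        ENNReal.ofReal (1 / 2) * ENNReal.ofReal (2 / ‖x‖ ^ 2) := by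
      intro x
      rw [← ENNReal.ofReal_mul (by norm_num)]
      congr 1
      ring
    simp_rw [h2]
    rw [lintegral_const_mul _ (by fun_prop), h, ← ENNReal.ofReal_mul (by norm_num)]
    congr 1
    have : (Module.finrank ℝ E : ℝ) - 2 ≠ 0 := by linarith
    have : -(-((Module.finrank ℝ E : ℝ) / 2) + 1) = ((Module.finrank ℝ E : ℝ) - 2) / 2 := by ring
    rw [this]
    field_simp
  · filter_upwards [ae_restrict_mem measurableSet_Ioi] with t ht
    have ht : 0 < t := ht
    positivity

/-- Only finiteness matters here: with a = 2 the integrand t(1 + t)^(-d/2) is at most (1 + t)^(1 −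
d/2), integrable for d > 4. -/
theorem lintegral_inv_norm_sq_sq_stdGaussian_lt_top (hE : 4 < Module.finrank ℝ E) :
    ∫⁻ x, ENNReal.ofReal (((‖x‖ ^ 2)⁻¹) ^ 2) ∂(stdGaussian E) < ∞ := by
  have h := lintegral_inv_norm_sq_rpow_stdGaussian (E := E) two_pos (by omega)
  have hr : (4 : ℝ) < Module.finrank ℝ E := by exact_mod_cast hE
  have ha : 1 - ((Module.finrank ℝ E : ℝ) / 2) < -1 := by linarith
  have h1 : ∀ x : E, ENNReal.ofReal (((‖x‖ ^ 2)⁻¹) ^ 2) ≤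
      ENNReal.ofReal ((2 / ‖x‖ ^ 2) ^ (2 : ℝ) * Real.Gamma 2) := by
    intro x
    refine ENNReal.ofReal_le_ofReal ?_
    rw [Real.Gamma_two, Real.rpow_two, div_eq_mul_inv]
    nlinarith [sq_nonneg ((‖x‖ ^ 2)⁻¹)]
  refine (lintegral_mono h1).trans_lt ?_
  rw [h]
  refine lt_of_le_of_lt (setLIntegral_mono' measurableSet_Ioi fun t ht ↦ ?_)
    (integrableOn_one_add_rpow ha).lintegral_lt_top
  refine ENNReal.ofReal_le_ofReal ?_
  have ht : 0 < t := ht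
  rw [sub_eq_add_neg 1, Real.rpow_add (by linarith), Real.rpow_one,
    show (2 : ℝ) - 1 = 1 by norm_num, Real.rpow_one]
  gcongr
  linarith

/-- By Pythagoras the Gaussian characteristic function at a sum of orthogonal vectors factors, which
gives both independence and the marginal laws. -/
theorem map_orthogonalProjection_prod_stdGaussian (K : Submodule ℝ E) :
    (stdGaussian E).map (fun x ↦ (Kᗮ.orthogonalProjectionOnto x, K.orthogonalProjectionOnto x)) =
      (stdGaussian Kᗮ).prod (stdGaussian K) := by
  have hm : Measurable
      (fun x : E ↦ (Kᗮ.orthogonalProjectionOnto x, K.orthogonalProjectionOnto x)) := by fun_prop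
  have := Measure.isProbabilityMeasure_map (μ := stdGaussian E) hm.aemeasurable
  refine charFun_eq_prod_iff.1 fun t ↦ ?_
  rw [Measure.map_map (by fun_prop) hm, charFun_apply,
    integral_map (Measurable.aemeasurable (by fun_prop))
      (Measurable.aestronglyMeasurable (by fun_prop))]
  have h : ∀ x : E, inner ℝ ((WithLp.toLp 2 ∘ fun x : E ↦
      (Kᗮ.orthogonalProjectionOnto x, K.orthogonalProjectionOnto x)) x) t =
      inner ℝ x ((t.fst : E) + (t.snd : E)) := by
    intro x
    rw [WithLp.prod_inner_apply, inner_add_right]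
    simp
  simp_rw [h]
  rw [← charFun_apply, charFun_stdGaussian, charFun_stdGaussian, charFun_stdGaussian,
    ← Complex.exp_add]
  congr 1
  have h2 : ‖(t.fst : E) + (t.snd : E)‖ ^ 2 = ‖t.fst‖ ^ 2 + ‖t.snd‖ ^ 2 := by
    rw [sq, norm_add_sq_eq_norm_sq_add_norm_sq_real, ← sq, ← sq]
    · rfl
    · exact Submodule.inner_left_of_mem_orthogonal t.snd.2 t.fst.2
  have h3 : ((‖(t.fst : E) + (t.snd : E)‖ : ℂ)) ^ 2 = (‖t.fst‖ : ℂ) ^ 2 + (‖t.snd‖ : ℂ) ^ 2 := by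
    exact_mod_cast h2
  rw [h3]
  ring_nf
  rfl

theorem map_orthogonalProjection_stdGaussian (K : Submodule ℝ E) :
    (stdGaussian E).map K.orthogonalProjectionOnto = stdGaussian K := by
  have h := congrArg (Measure.map Prod.snd) (map_orthogonalProjection_prod_stdGaussian K)
  rw [Measure.map_map (by fun_prop) (by fun_prop), Measure.map_snd_prod] at h
  rw [measure_univ, one_smul] at h
  exact h

theorem integral_norm_sq_stdGaussian :
    ∫ x, ‖x‖ ^ 2 ∂(stdGaussian E) = Module.finrank ℝ E := by
  rw [stdGaussian, integral_map (Measurable.aemeasurable (by fun_prop))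
    (Measurable.aestronglyMeasurable (by fun_prop))]
  simp_rw [norm_sq_sum_smul_orthonormalBasis]
  have h1 : ∀ i : Fin (Module.finrank ℝ E), Integrable (fun x ↦ x i ^ 2)
      (Measure.pi fun _ : Fin (Module.finrank ℝ E) ↦ gaussianReal 0 1) := fun i ↦
    integrable_comp_eval (μ := fun _ ↦ gaussianReal 0 1) (i := i) (f := fun x : ℝ ↦ x ^ 2)
      (IsGaussian.memLp_two_id (μ := gaussianReal 0 1)).integrable_sq
  rw [integral_finsetSum _ fun i _ ↦ h1 i]
  have h2 : ∫ x, x ^ 2 ∂(gaussianReal 0 1) = 1 := by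
    have := variance_id_gaussianReal (μ := 0) (v := 1)
    rw [variance_eq_sub IsGaussian.memLp_two_id] at this
    simpa using this
  have h3 : ∀ i : Fin (Module.finrank ℝ E), ∫ x, x i ^ 2
      ∂(Measure.pi fun _ : Fin (Module.finrank ℝ E) ↦ gaussianReal 0 1) = 1 := fun i ↦ by
    rw [integral_comp_eval (μ := fun _ ↦ gaussianReal 0 1) (i := i) (f := fun x : ℝ ↦ x ^ 2) (Measurable.aestronglyMeasurable (by fun_prop)), h2]
  simp [h3]

end ProbabilityTheory

/-! ### Inverse Gram matrices, and almost sure independence of Gaussian vectors. -/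

section Gram

variable {F : Type*} [NormedAddCommGroup F] [InnerProductSpace ℝ F] {ι : Type*} [Fintype ι]
  [DecidableEq ι]

/-- The diagonal entries of an inverse Gram matrix are the inverse squared lengths of the
residuals of each vector after projection onto the span of the others. -/
theorem Matrix.inv_gram_apply_self [FiniteDimensional ℝ F] {v : ι → F}
    (hv : LinearIndependent ℝ v) (j : ι) :
    (Matrix.gram ℝ v)⁻¹ j j =
      (‖(Submodule.span ℝ (v '' {j}ᶜ))ᗮ.orthogonalProjectionOnto (v j)‖ ^ 2)⁻¹ := by
  set V := Submodule.span ℝ (v '' {j}ᶜ) with hV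
  -- Column j of the inverse Gram matrix makes x dual to the family: ⟨v k, x⟩ = δ_kj. Hence x lies
  -- in Vᗮ, and projecting its expansion there leaves only a j times the residual of v j.
  set a : ι → ℝ := fun k ↦ (Matrix.gram ℝ v)⁻¹ k j with ha
  set x : F := ∑ k, a k • v k with hx
  have hunit : IsUnit (Matrix.gram ℝ v).det :=
    (Matrix.det_gram_ne_zero_iff_linearIndependent.2 hv).isUnit
  have hinner : ∀ k, inner ℝ (v k) x = (1 : Matrix ι ι ℝ) k j := by
    intro k
    rw [← Matrix.mul_nonsing_inv _ hunit, Matrix.mul_apply, hx, inner_sum]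
    simp [inner_smul_right, ha, mul_comm]
  have hxV : x ∈ Vᗮ := by
    rw [Submodule.mem_orthogonal]
    intro u hu
    induction hu using Submodule.span_induction with
    | mem u hu =>
      obtain ⟨k, hk, rfl⟩ := hu
      rw [hinner, Matrix.one_apply_ne hk]
    | zero => simp
    | add u w _ _ hu hw => rw [inner_add_left, hu, hw, add_zero]
    | smul c u _ hu => rw [inner_smul_left, hu, mul_zero]
  have hPx : Vᗮ.orthogonalProjectionOnto x = a j • Vᗮ.orthogonalProjectionOnto (v j) := by
    rw [hx, map_sum, Finset.sum_eq_single j]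
    · rw [map_smul]
    · intro k _ hk
      rw [map_smul, Submodule.orthogonalProjectionOnto_eq_zero_iff.2, smul_zero]
      exact Submodule.le_orthogonal_orthogonal _ (Submodule.subset_span ⟨k, hk, rfl⟩)
    · simp
  have h1 : inner ℝ (v j) x = a j * ‖Vᗮ.orthogonalProjectionOnto (v j)‖ ^ 2 := by
    have h2 : (Vᗮ.orthogonalProjectionOnto x : F) = x :=
      Submodule.starProjection_eq_self_iff.2 hxV
    rw [← h2, ← Submodule.inner_orthogonalProjectionOnto_eq_of_mem_right, hPx, inner_smul_right,
      real_inner_self_eq_norm_sq]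
  rw [hinner, Matrix.one_apply_eq] at h1
  exact eq_inv_of_mul_eq_one_left h1.symm

end Gram

namespace MeasureTheory

/-- Resampling a single coordinate leaves the product law unchanged; this serves as conditioning on
all the other coordinates. -/
theorem lintegral_pi_update {ι : Type*} [Fintype ι] [DecidableEq ι] {X : ι → Type*}
    [∀ i, MeasurableSpace (X i)] (μ : ∀ i, Measure (X i)) [∀ i, IsProbabilityMeasure (μ i)]
    {f : (∀ i, X i) → ℝ≥0∞} (hf : Measurable f) (j : ι) :
    ∫⁻ z, f z ∂(Measure.pi μ) =
      ∫⁻ z, ∫⁻ x, f (Function.update z j x) ∂(μ j) ∂(Measure.pi μ) := by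
  have hg : (fun z ↦ ∫⁻ x, f (Function.update z j x) ∂(μ j)) = ∫⋯∫⁻_{j}, f ∂μ := by
    ext z
    rw [lmarginal_singleton]
  rw [hg]
  refine lintegral_eq_of_lmarginal_eq {j} hf (hf.lmarginal μ) ?_
  ext z
  rw [lmarginal_singleton (f := ∫⋯∫⁻_{j}, f ∂μ)]
  simp [lmarginal_update_of_mem μ (Finset.mem_singleton_self j)]

end MeasureTheory

namespace ProbabilityTheory

variable {E : Type*} [NormedAddCommGroup E] [InnerProductSpace ℝ E] [FiniteDimensional ℝ E]
  [MeasurableSpace E] [BorelSpace E]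

/-- The law of the norm depends on the dimension alone, so a space that varies with the conditioning
can be replaced by a fixed one. -/
theorem lintegral_norm_stdGaussian {r : ℕ} (hr : Module.finrank ℝ E = r) {g : ℝ → ℝ≥0∞}
    (hg : Measurable g) :
    ∫⁻ x, g ‖x‖ ∂(stdGaussian E) = ∫⁻ x, g ‖x‖ ∂(stdGaussian (EuclideanSpace ℝ (Fin r))) := by
  subst hr
  rw [← stdGaussian_map (stdOrthonormalBasis ℝ E).repr, lintegral_map (by fun_prop) (by fun_prop)]
  simp

theorem measurable_gram_apply {ι : Type*} (i j : ι) :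
    Measurable fun z : ι → E ↦ Matrix.gram ℝ z i j := by
  simp only [Matrix.gram_apply]
  fun_prop

theorem measurable_matrix_det {α ι : Type*} [MeasurableSpace α] [Fintype ι] [DecidableEq ι]
    {M : α → Matrix ι ι ℝ} (hM : ∀ i j, Measurable fun a ↦ M a i j) :
    Measurable fun a ↦ (M a).det := by
  simp only [Matrix.det_apply']
  fun_prop

theorem measurable_matrix_inv_apply {α ι : Type*} [MeasurableSpace α] [Fintype ι] [DecidableEq ι]
    {M : α → Matrix ι ι ℝ} (hM : ∀ i j, Measurable fun a ↦ M a i j) (i j : ι) :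
    Measurable fun a ↦ (M a)⁻¹ i j := by
  simp only [Matrix.inv_def, Matrix.smul_apply, smul_eq_mul, Ring.inverse_eq_inv',
    Matrix.adjugate_apply]
  refine (measurable_matrix_det hM).inv.mul (measurable_matrix_det fun k l ↦ ?_)
  simp only [Matrix.updateRow_apply]
  split_ifs
  · exact measurable_const
  · exact hM k l

theorem measurableSet_linearIndependent {ι : Type*} [Fintype ι] [DecidableEq ι] :
    MeasurableSet {z : ι → E | LinearIndependent ℝ z} := by
  simp_rw [← Matrix.det_gram_ne_zero_iff_linearIndependent]
  exact (measurable_matrix_det measurable_gram_apply) (measurableSet_singleton 0).compl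

omit [FiniteDimensional ℝ E] [MeasurableSpace E] [BorelSpace E] in
theorem span_range_ne_top {ι : Type*} [Fintype ι] {v : ι → E}
    (h : Fintype.card ι < Module.finrank ℝ E) : Submodule.span ℝ (Set.range v) ≠ ⊤ := by
  intro htop
  have := finrank_range_le_card (R := ℝ) v
  rw [Set.finrank, htop, finrank_top] at this
  omega

/-- Independent standard Gaussian vectors are almost surely linearly independent. -/
theorem ae_linearIndependent_pi_stdGaussian {q : ℕ} (hq : q ≤ Module.finrank ℝ E) :
    ∀ᵐ z ∂(Measure.pi fun _ : Fin q ↦ stdGaussian E), LinearIndependent ℝ z := by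
  induction q with
  | zero => exact .of_forall fun z ↦ linearIndependent_empty_type
  | succ q ih =>
    have hmp := (measurePreserving_piFinSuccAbove (fun _ : Fin (q + 1) ↦ stdGaussian E) 0).symm
    rw [← hmp.map_eq, ae_map_iff hmp.measurable.aemeasurable measurableSet_linearIndependent]
    have hms : MeasurableSet {x : E × (Fin q → E) | LinearIndependent ℝ
        ((MeasurableEquiv.piFinSuccAbove (fun _ ↦ E) 0).symm x)} :=
      hmp.measurable measurableSet_linearIndependent
    -- The factors are swapped so that the q earlier vectors are fixed first; the new vector then
    -- avoids their span almost surely.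
    rw [← Measure.prod_swap, ae_map_iff measurable_swap.aemeasurable hms]
    refine (Measure.ae_prod_iff_ae_ae (p := fun x ↦ LinearIndependent ℝ
      ((MeasurableEquiv.piFinSuccAbove (fun _ ↦ E) 0).symm x.swap)) (measurable_swap hms)).2 ?_
    filter_upwards [ih (by omega)] with z hz
    filter_upwards [ae_notMem_stdGaussian (span_range_ne_top (v := z) (by simpa using hq))]
      with x hx
    have h : (MeasurableEquiv.piFinSuccAbove (fun _ : Fin (q + 1) ↦ E) 0).symm (x, z) =
        Fin.cons x z := by
      ext i
      simp [MeasurableEquiv.piFinSuccAbove, Fin.insertNthEquiv]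
    change LinearIndependent ℝ ((MeasurableEquiv.piFinSuccAbove (fun _ ↦ E) 0).symm (x, z))
    rw [h, linearIndependent_finCons]
    exact ⟨hz, hx⟩

omit [MeasurableSpace E] [BorelSpace E] in
-- Residual degrees of freedom: the other vectors number `card ι` − 1, whence the + 1. The
-- subtraction does not truncate, since independence bounds `card ι` by the dimension.
theorem finrank_orthogonal_span_compl {ι : Type*} [Fintype ι] [DecidableEq ι] {v : ι → E}
    (hv : LinearIndependent ℝ v) (j : ι) :
    Module.finrank ℝ (Submodule.span ℝ (v '' {j}ᶜ))ᗮ =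
      Module.finrank ℝ E + 1 - Fintype.card ι := by
  have h1 := (Submodule.span ℝ (v '' {j}ᶜ)).finrank_add_finrank_orthogonal
  have hli : LinearIndependent ℝ (fun k : ({j}ᶜ : Set ι) ↦ v k) :=
    hv.comp _ Subtype.val_injective
  have h2 := finrank_span_eq_card hli
  have h3 : Set.range (fun k : ({j}ᶜ : Set ι) ↦ v k) = v '' {j}ᶜ := by
    rw [Set.image_eq_range]
  rw [h3, Fintype.card_compl_set] at h2
  simp only [Set.card_singleton] at h2
  have h4 := hv.fintype_card_le_finrank
  have h5 : 0 < Fintype.card ι := Fintype.card_pos_iff.2 ⟨j⟩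
  omega

/-- The diagonal entries of an inverse Wishart matrix are distributed as the inverse of a
chi-square variable. -/
theorem lintegral_inv_gram_apply_self {q : ℕ} (hq : q ≤ Module.finrank ℝ E) (j : Fin q)
    {g : ℝ → ℝ≥0∞} (hg : Measurable g) :
    ∫⁻ z, g ((Matrix.gram ℝ z)⁻¹ j j) ∂(Measure.pi fun _ : Fin q ↦ stdGaussian E) =
      ∫⁻ x, g ((‖x‖ ^ 2)⁻¹)
        ∂(stdGaussian (EuclideanSpace ℝ (Fin (Module.finrank ℝ E + 1 - q)))) := by
  have hm : Measurable fun z : Fin q → E ↦ g ((Matrix.gram ℝ z)⁻¹ j j) :=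
    hg.comp (measurable_matrix_inv_apply measurable_gram_apply j j)
  rw [lintegral_pi_update _ hm j]
  have hae : ∀ᵐ z ∂(Measure.pi fun _ : Fin q ↦ stdGaussian E),
      ∫⁻ x, g ((Matrix.gram ℝ (Function.update z j x))⁻¹ j j) ∂(stdGaussian E) =
      ∫⁻ x, g ((‖x‖ ^ 2)⁻¹)
        ∂(stdGaussian (EuclideanSpace ℝ (Fin (Module.finrank ℝ E + 1 - q)))) := by
    filter_upwards [ae_linearIndependent_pi_stdGaussian hq] with z hz
    -- V does not involve z j, so it stays fixed while coordinate j is resampled. The entry then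
    -- depends only on the projection to Vᗮ of a fresh Gaussian vector.
    set V := Submodule.span ℝ (z '' {j}ᶜ) with hV
    have hr : Module.finrank ℝ Vᗮ = Module.finrank ℝ E + 1 - q := by
      simpa using finrank_orthogonal_span_compl hz j
    have hVtop : V ≠ ⊤ := by
      intro h
      have hr' := hr
      rw [h, Submodule.top_orthogonal_eq_bot, finrank_bot] at hr'
      omega
    have himg : ∀ x, Function.update z j x '' {j}ᶜ = z '' {j}ᶜ := fun x ↦
      Set.image_congr fun k hk ↦ Function.update_of_ne hk _ _
    rw [← lintegral_norm_stdGaussian hr (g := fun s ↦ g ((s ^ 2)⁻¹)) (by fun_prop),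
      ← map_orthogonalProjection_stdGaussian Vᗮ, lintegral_map (by fun_prop) (by fun_prop)]
    refine lintegral_congr_ae ?_
    filter_upwards [ae_notMem_stdGaussian hVtop] with x hx
    have hli : LinearIndependent ℝ (Function.update z j x) := by
      have hins : insert j ({j}ᶜ : Set (Fin q)) = Set.univ := by
        ext k
        simp [em]
      rw [← linearIndepOn_univ_iff, ← hins, linearIndepOn_insert (by simp), himg,
        Function.update_self]
      exact ⟨(hz.linearIndepOn _).congr fun k hk ↦ (Function.update_of_ne hk _ _).symm, hx⟩
    rw [Matrix.inv_gram_apply_self hli, himg, Function.update_self]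
  rw [lintegral_congr_ae hae]
  simp

end ProbabilityTheory

/-! ### Bounds on entries and log-determinants by traces. -/

namespace Matrix

variable {ι : Type*} [Fintype ι] [DecidableEq ι]

omit [DecidableEq ι] in
open scoped MatrixOrder Matrix.Norms.L2Operator in
-- Factor A as BᵀB and use |xy| ≤ x² + y². Off-diagonal entries thereby inherit integrability from
-- diagonal ones.
theorem PosSemidef.abs_apply_le {A : Matrix ι ι ℝ} (hA : A.PosSemidef) (i j : ι) :
    |A i j| ≤ A i i + A j j := by
  classical
  obtain ⟨B, rfl⟩ := CStarAlgebra.nonneg_iff_eq_star_mul_self.1 hA.nonneg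
  simp only [Matrix.mul_apply, Matrix.star_apply, star_trivial, ← Finset.sum_add_distrib]
  refine (Finset.abs_sum_le_sum_abs _ _).trans (Finset.sum_le_sum fun k _ ↦ ?_)
  rw [abs_le]
  constructor <;> nlinarith [sq_nonneg (B k i + B k j), sq_nonneg (B k i - B k j),
    sq_nonneg (B k i), sq_nonneg (B k j)]

theorem PosDef.log_det_le_trace {A : Matrix ι ι ℝ} (hA : A.PosDef) :
    Real.log A.det ≤ A.trace := by
  rw [hA.1.det_eq_prod_eigenvalues, hA.1.trace_eq_sum_eigenvalues]
  simp only [RCLike.ofReal_real_eq_id, id_eq]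
  rw [Real.log_prod fun i _ ↦ (hA.eigenvalues_pos i).ne']
  refine Finset.sum_le_sum fun i _ ↦ ?_
  linarith [Real.log_le_sub_one_of_pos (hA.eigenvalues_pos i)]

/-- From log λ ≤ λ on the eigenvalues of A and of A⁻¹; the inverse supplies the lower bound on log
det A. -/
theorem PosDef.abs_log_det_le {A : Matrix ι ι ℝ} (hA : A.PosDef) :
    |Real.log A.det| ≤ A.trace + A⁻¹.trace := by
  have h1 := hA.log_det_le_trace
  have h2 := hA.inv.log_det_le_trace
  rw [Matrix.det_nonsing_inv, Ring.inverse_eq_inv', Real.log_inv] at h2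
  have h3 := hA.posSemidef.trace_nonneg
  have h4 := hA.inv.posSemidef.trace_nonneg
  rw [abs_le]
  constructor <;> linarith

end Matrix

/-! ### Moments of Wishart and inverse Wishart matrices. -/

namespace ProbabilityTheory

variable {E : Type*} [NormedAddCommGroup E] [InnerProductSpace ℝ E] [FiniteDimensional ℝ E]
  [MeasurableSpace E] [BorelSpace E] {q : ℕ}

variable (E q) in
/-- The law of `q` independent standard Gaussian vectors of `E`. -/
abbrev stdGaussianFamily : Measure (Fin q → E) := Measure.pi fun _ ↦ stdGaussian E

omit [FiniteDimensional ℝ E] [MeasurableSpace E] [BorelSpace E] in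
theorem inv_gram_apply_self_nonneg (z : Fin q → E) (j : Fin q) :
    0 ≤ (Matrix.gram ℝ z)⁻¹ j j :=
  (Matrix.posSemidef_gram ℝ z).inv.diag_nonneg

theorem lintegral_ofReal_inv_gram_apply_self (hq : q + 1 < Module.finrank ℝ E) (j : Fin q) :
    ∫⁻ z, ENNReal.ofReal ((Matrix.gram ℝ z)⁻¹ j j) ∂(stdGaussianFamily E q) =
      ENNReal.ofReal (((Module.finrank ℝ E : ℝ) - q - 1)⁻¹) := by
  rw [lintegral_inv_gram_apply_self (by omega) j ENNReal.measurable_ofReal,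
    lintegral_inv_norm_sq_stdGaussian (by rw [finrank_euclideanSpace_fin]; omega),
    finrank_euclideanSpace_fin, Nat.cast_sub (by omega)]
  congr 2
  push_cast
  ring

theorem integrable_inv_gram_apply_self (hq : q + 1 < Module.finrank ℝ E) (j : Fin q) :
    Integrable (fun z : Fin q → E ↦ (Matrix.gram ℝ z)⁻¹ j j) (stdGaussianFamily E q) := by
  refine (lintegral_ofReal_ne_top_iff_integrable
    (measurable_matrix_inv_apply measurable_gram_apply j j).aestronglyMeasurable
    (.of_forall fun z ↦ inv_gram_apply_self_nonneg z j)).1 ?_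
  rw [lintegral_ofReal_inv_gram_apply_self hq]
  exact ENNReal.ofReal_ne_top

theorem integral_inv_gram_apply_self (hq : q + 1 < Module.finrank ℝ E) (j : Fin q) :
    ∫ z, (Matrix.gram ℝ z)⁻¹ j j ∂(stdGaussianFamily E q) =
      ((Module.finrank ℝ E : ℝ) - q - 1)⁻¹ := by
  rw [integral_eq_lintegral_of_nonneg_ae (.of_forall fun z ↦ inv_gram_apply_self_nonneg z j)
    (measurable_matrix_inv_apply measurable_gram_apply j j).aestronglyMeasurable,
    lintegral_ofReal_inv_gram_apply_self hq, ENNReal.toReal_ofReal]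
  have : (q : ℝ) + 1 < Module.finrank ℝ E := by exact_mod_cast hq
  rw [inv_nonneg]
  linarith

/-- The chi-square variable has dim E + 1 − q degrees of freedom, and a second inverse moment needs
more than 4. -/
theorem memLp_two_inv_gram_apply_self (hq : q + 3 < Module.finrank ℝ E) (j : Fin q) :
    MemLp (fun z : Fin q → E ↦ (Matrix.gram ℝ z)⁻¹ j j) 2 (stdGaussianFamily E q) := by
  have hm := measurable_matrix_inv_apply (measurable_gram_apply (E := E)) j j
  rw [memLp_two_iff_integrable_sq hm.aestronglyMeasurable]
  refine (lintegral_ofReal_ne_top_iff_integrable (hm.pow_const 2).aestronglyMeasurable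
    (.of_forall fun z ↦ sq_nonneg _)).1 ?_
  rw [lintegral_inv_gram_apply_self (by omega) j
    (g := fun s ↦ ENNReal.ofReal (s ^ 2)) (by fun_prop)]
  exact (lintegral_inv_norm_sq_sq_stdGaussian_lt_top
    (by rw [finrank_euclideanSpace_fin]; omega)).ne

theorem memLp_inv_gram_apply {r : ℝ≥0∞}
    (h : ∀ j, MemLp (fun z : Fin q → E ↦ (Matrix.gram ℝ z)⁻¹ j j) r (stdGaussianFamily E q))
    (i j : Fin q) :
    MemLp (fun z : Fin q → E ↦ (Matrix.gram ℝ z)⁻¹ i j) r (stdGaussianFamily E q) :=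
  ((h i).add (h j)).mono (measurable_matrix_inv_apply measurable_gram_apply i j).aestronglyMeasurable
    (.of_forall fun z ↦ ((Matrix.posSemidef_gram ℝ z).inv.abs_apply_le i j).trans (le_abs_self _))

theorem memLp_two_norm_sq_stdGaussianFamily (j : Fin q) :
    MemLp (fun v : Fin q → E ↦ ‖v j‖ ^ 2) 2 (stdGaussianFamily E q) := by
  rw [memLp_two_iff_integrable_sq (Measurable.aestronglyMeasurable (by fun_prop))]
  have h := (IsGaussian.memLp_id (stdGaussian E) 4 (by simp)).integrable_norm_pow (p := 4)
    (by norm_num)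
  refine (integrable_comp_eval (μ := fun _ : Fin q ↦ stdGaussian E) (i := j) h).congr
    (.of_forall fun v ↦ ?_)
  simp only [id_eq]
  ring

theorem memLp_two_gram_apply (i j : Fin q) :
    MemLp (fun v : Fin q → E ↦ Matrix.gram ℝ v i j) 2 (stdGaussianFamily E q) := by
  refine ((memLp_two_norm_sq_stdGaussianFamily i).add (memLp_two_norm_sq_stdGaussianFamily j)).mono
    (measurable_gram_apply i j).aestronglyMeasurable (.of_forall fun v ↦ ?_)
  have h := (Matrix.posSemidef_gram ℝ v).abs_apply_le i j
  simp only [Matrix.gram_apply, real_inner_self_eq_norm_sq] at h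
  exact h.trans (le_abs_self _)

theorem integral_gram_apply_self (j : Fin q) :
    ∫ v, Matrix.gram ℝ v j j ∂(stdGaussianFamily E q) = Module.finrank ℝ E := by
  simp only [Matrix.gram_apply, real_inner_self_eq_norm_sq]
  rw [integral_comp_eval (μ := fun _ : Fin q ↦ stdGaussian E) (i := j) (f := fun x ↦ ‖x‖ ^ 2)
    (Measurable.aestronglyMeasurable (by fun_prop)), integral_norm_sq_stdGaussian]

/-- Flipping the sign of the i-th vector preserves the law and negates the entry. -/
theorem integral_gram_apply_of_ne {i j : Fin q} (hij : i ≠ j) :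
    ∫ v, Matrix.gram ℝ v i j ∂(stdGaussianFamily E q) = 0 := by
  have hmp : MeasurePreserving
      (fun (v : Fin q → E) k ↦ (if k = i then fun x ↦ -x else id : E → E) (v k))
      (stdGaussianFamily E q) (stdGaussianFamily E q) := by
    refine measurePreserving_pi _ _ fun k ↦ ?_
    split_ifs
    · exact ⟨measurable_neg, stdGaussian_map (LinearIsometryEquiv.neg ℝ)⟩
    · exact .id _
  have h := integral_map (μ := stdGaussianFamily E q) hmp.measurable.aemeasurable
    (f := fun v ↦ Matrix.gram ℝ v i j) (measurable_gram_apply i j).aestronglyMeasurable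
  rw [hmp.map_eq] at h
  simp only [Matrix.gram_apply, if_true, if_neg hij.symm, id_eq, inner_neg_left,
    integral_neg] at h ⊢
  linarith

theorem integrable_log_det_gram (hq : q + 1 < Module.finrank ℝ E) :
    Integrable (fun z : Fin q → E ↦ Real.log (Matrix.gram ℝ z).det) (stdGaussianFamily E q) := by
  have h1 : Integrable (fun z : Fin q → E ↦ (Matrix.gram ℝ z).trace) (stdGaussianFamily E q) :=
    integrable_finsetSum _ fun j _ ↦ (memLp_two_gram_apply j j).integrable one_le_two
  have h2 : Integrable (fun z : Fin q → E ↦ (Matrix.gram ℝ z)⁻¹.trace) (stdGaussianFamily E q) :=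
    integrable_finsetSum _ fun j _ ↦ integrable_inv_gram_apply_self hq j
  refine (h1.add h2).mono
    (measurable_matrix_det measurable_gram_apply).log.aestronglyMeasurable ?_
  filter_upwards [ae_linearIndependent_pi_stdGaussian (q := q) (E := E) (by omega)] with z hz
  exact (Matrix.posDef_gram_of_linearIndependent hz).abs_log_det_le.trans (le_abs_self _)

variable {F : Type*} [NormedAddCommGroup F] [InnerProductSpace ℝ F] [FiniteDimensional ℝ F]
  [MeasurableSpace F] [BorelSpace F]

omit [FiniteDimensional ℝ E] [MeasurableSpace E] [BorelSpace E] [FiniteDimensional ℝ F]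
  [MeasurableSpace F] [BorelSpace F] in
theorem trace_inv_gram_mul_gram (u : Fin q → E) (v : Fin q → F) :
    ((Matrix.gram ℝ u)⁻¹ * Matrix.gram ℝ v).trace =
      ∑ i, ∑ j, (Matrix.gram ℝ u)⁻¹ i j * Matrix.gram ℝ v j i := by
  simp [Matrix.trace, Matrix.mul_apply]

theorem integrable_trace_inv_gram_mul_gram (hq : q + 1 < Module.finrank ℝ E) :
    Integrable (fun w : (Fin q → E) × (Fin q → F) ↦
        ((Matrix.gram ℝ w.1)⁻¹ * Matrix.gram ℝ w.2).trace)
      ((stdGaussianFamily E q).prod (stdGaussianFamily F q)) := by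
  simp only [trace_inv_gram_mul_gram]
  refine integrable_finsetSum _ fun i _ ↦ integrable_finsetSum _ fun j _ ↦ ?_
  have h1 := memLp_one_iff_integrable.1 (memLp_inv_gram_apply
    (fun j ↦ memLp_one_iff_integrable.2 (integrable_inv_gram_apply_self hq j)) i j)
  exact h1.mul_prod ((memLp_two_gram_apply j i).integrable one_le_two)

/-- Independence factors each expectation, and the terms off the diagonal vanish because the second
Gram matrix has mean proportional to I. -/
theorem integral_trace_inv_gram_mul_gram (hq : q + 1 < Module.finrank ℝ E) :
    ∫ w, ((Matrix.gram ℝ w.1)⁻¹ * Matrix.gram ℝ w.2).trace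
      ∂((stdGaussianFamily E q).prod (stdGaussianFamily F q)) =
    q * Module.finrank ℝ F / ((Module.finrank ℝ E : ℝ) - q - 1) := by
  have h1 := fun i j ↦ memLp_one_iff_integrable.1 (memLp_inv_gram_apply
    (fun j ↦ memLp_one_iff_integrable.2 (integrable_inv_gram_apply_self (E := E) hq j)) i j)
  have h2 : ∀ i j, Integrable (fun w : (Fin q → E) × (Fin q → F) ↦
      (Matrix.gram ℝ w.1)⁻¹ i j * Matrix.gram ℝ w.2 j i)
      ((stdGaussianFamily E q).prod (stdGaussianFamily F q)) := fun i j ↦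
    (h1 i j).mul_prod ((memLp_two_gram_apply j i).integrable one_le_two)
  simp only [trace_inv_gram_mul_gram]
  rw [integral_finsetSum _ fun i _ ↦ integrable_finsetSum _ fun j _ ↦ h2 i j]
  have h3 : ∀ i, ∫ w, ∑ j, (Matrix.gram ℝ w.1)⁻¹ i j * Matrix.gram ℝ w.2 j i
      ∂((stdGaussianFamily E q).prod (stdGaussianFamily F q)) =
      Module.finrank ℝ F / ((Module.finrank ℝ E : ℝ) - q - 1) := by
    intro i
    rw [integral_finsetSum _ fun j _ ↦ h2 i j, Finset.sum_eq_single i]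
    · rw [integral_prod_mul (fun u ↦ (Matrix.gram ℝ u)⁻¹ i i) (fun v ↦ Matrix.gram ℝ v i i),
        integral_inv_gram_apply_self hq, integral_gram_apply_self]
      ring
    · intro j _ hj
      rw [integral_prod_mul (fun u ↦ (Matrix.gram ℝ u)⁻¹ i j) (fun v ↦ Matrix.gram ℝ v j i),
        integral_gram_apply_of_ne hj, mul_zero]
    · simp
  simp only [h3, Finset.sum_const, Finset.card_univ, Fintype.card_fin, nsmul_eq_mul]
  ring

/-- For independent factors the square of a product has a factored integral, so square integrability
of each factor suffices; no fourth moments are needed. -/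
theorem memLp_two_trace_inv_gram_mul_gram (hq : q + 3 < Module.finrank ℝ E) :
    MemLp (fun w : (Fin q → E) × (Fin q → F) ↦
        ((Matrix.gram ℝ w.1)⁻¹ * Matrix.gram ℝ w.2).trace) 2
      ((stdGaussianFamily E q).prod (stdGaussianFamily F q)) := by
  simp only [trace_inv_gram_mul_gram]
  refine memLp_finsetSum _ fun i _ ↦ memLp_finsetSum _ fun j _ ↦ ?_
  have hm : Measurable fun w : (Fin q → E) × (Fin q → F) ↦
      (Matrix.gram ℝ w.1)⁻¹ i j * Matrix.gram ℝ w.2 j i :=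
    ((measurable_matrix_inv_apply measurable_gram_apply i j).comp measurable_fst).mul
      ((measurable_gram_apply j i).comp measurable_snd)
  rw [memLp_two_iff_integrable_sq hm.aestronglyMeasurable]
  simp only [mul_pow]
  exact (memLp_inv_gram_apply (memLp_two_inv_gram_apply_self hq) i j).integrable_sq.mul_prod
    (memLp_two_gram_apply j i).integrable_sq

end ProbabilityTheory

/-! ### Standardized data, split into fitted and residual parts. -/

namespace MVRegression

open scoped MatrixOrder

variable {n p q : ℕ}

theorem sqrt_mul_sqrt {S : Matrix (Fin q) (Fin q) ℝ} (hS : S.PosDef) :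
    CFC.sqrt S * CFC.sqrt S = S :=
  CFC.sqrt_mul_sqrt_self S hS.posSemidef.nonneg

theorem transpose_sqrt (S : Matrix (Fin q) (Fin q) ℝ) : (CFC.sqrt S)ᵀ = CFC.sqrt S := by
  simpa [Matrix.star_eq_conjTranspose] using (CFC.sqrt_nonneg S).isSelfAdjoint.star_eq

theorem isUnit_det_sqrt {S : Matrix (Fin q) (Fin q) ℝ} (hS : S.PosDef) :
    IsUnit (CFC.sqrt S).det := by
  have h := congrArg Matrix.det (sqrt_mul_sqrt hS)
  rw [Matrix.det_mul] at h
  refine isUnit_iff_ne_zero.2 fun h0 ↦ hS.det_pos.ne' ?_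
  rw [← h, h0, zero_mul]

/-- The standardized observation `Σ^(-1/2) (yᵢ - Bᵀ xᵢ)`. -/
def standardize (X : Matrix (Fin n) (Fin p) ℝ) (θ : Param p q) (Y : Sample n q) : Sample n q :=
  fun i ↦ Matrix.toEuclideanCLM (𝕜 := ℝ) (CFC.sqrt θ.2.1)⁻¹ (Y i - rowMean X θ.1 i)

theorem measurePreserving_standardize_row {S : Matrix (Fin q) (Fin q) ℝ} (hS : S.PosDef)
    (μ : EuclideanSpace ℝ (Fin q)) :
    MeasurePreserving
      (fun y ↦ Matrix.toEuclideanCLM (𝕜 := ℝ) (CFC.sqrt S)⁻¹ (y - μ))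
      (multivariateGaussian μ S) (stdGaussian (EuclideanSpace ℝ (Fin q))) := by
  refine ⟨by fun_prop, ?_⟩
  rw [multivariateGaussian, Measure.map_map (by fun_prop) (by fun_prop)]
  have h : ((fun y ↦ Matrix.toEuclideanCLM (𝕜 := ℝ) (CFC.sqrt S)⁻¹ (y - μ)) ∘
      fun x ↦ μ + Matrix.toEuclideanCLM (𝕜 := ℝ) (CFC.sqrt S) x) = id := by
    ext1 x
    simp only [Function.comp_apply, add_sub_cancel_left, id_eq]
    rw [← ContinuousLinearMap.comp_apply, ← ContinuousLinearMap.mul_def, ← map_mul,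
      Matrix.nonsing_inv_mul _ (isUnit_det_sqrt hS), map_one, one_apply_eq_self]
  rw [h, Measure.map_id]

theorem measurePreserving_standardize (X : Matrix (Fin n) (Fin p) ℝ) (θ : Param p q) :
    MeasurePreserving (standardize X θ) (law X θ)
      (Measure.pi fun _ : Fin n ↦ stdGaussian (EuclideanSpace ℝ (Fin q))) :=
  measurePreserving_pi _ _ fun i ↦ measurePreserving_standardize_row θ.2.2 (rowMean X θ.1 i)

/-- The columns of the data matrix. -/
def columns (Z : Sample n q) (j : Fin q) : EuclideanSpace ℝ (Fin n) :=
  WithLp.toLp 2 fun i ↦ Z i j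

theorem measurable_columns : Measurable (columns : Sample n q → _) := by
  refine measurable_pi_lambda _ fun j ↦ ?_
  unfold columns
  fun_prop

/-- The characteristic function of the array depends only on the sum of the squares of all entries,
which can be taken by rows or by columns. -/
theorem measurePreserving_columns :
    MeasurePreserving (columns : Sample n q → _)
      (Measure.pi fun _ : Fin n ↦ stdGaussian (EuclideanSpace ℝ (Fin q)))
      (stdGaussianFamily (EuclideanSpace ℝ (Fin n)) q) := by
  refine ⟨measurable_columns, charFun_eq_pi_iff.1 fun t ↦ ?_⟩
  have hm : Measurable (WithLp.toLp 2 : (Fin q → EuclideanSpace ℝ (Fin n)) → _) := by fun_prop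
  have hm' : Measurable (WithLp.toLp 2 : Sample n q → _) := by fun_prop
  have h := charFun_pi (μ := fun _ : Fin n ↦ stdGaussian (EuclideanSpace ℝ (Fin q)))
    (WithLp.toLp 2 fun i ↦ WithLp.toLp 2 fun j ↦ t j i)
  rw [charFun_apply, integral_map hm'.aemeasurable
    (Measurable.aestronglyMeasurable (by fun_prop))] at h
  rw [Measure.map_map hm measurable_columns, charFun_apply,
    integral_map (hm.comp measurable_columns).aemeasurable
      (Measurable.aestronglyMeasurable (by fun_prop))]
  have hinner : ∀ Z : Sample n q, inner ℝ ((WithLp.toLp 2 ∘ columns) Z) t =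
      inner ℝ (WithLp.toLp 2 Z) (WithLp.toLp 2 fun i ↦
        (WithLp.toLp 2 fun j ↦ t j i : EuclideanSpace ℝ (Fin q))) := by
    intro Z
    simp only [PiLp.inner_apply, Function.comp_apply, columns]
    rw [Finset.sum_comm]
  simp_rw [hinner]
  rw [h]
  simp only [charFun_stdGaussian, ← Complex.exp_sum, ← Complex.ofReal_pow,
    EuclideanSpace.real_norm_sq_eq, Complex.ofReal_sum, ← Finset.sum_div, ← Finset.sum_neg_distrib]
  rw [Finset.sum_comm]

/-- The column space of the design matrix. -/
abbrev colSpace (X : Matrix (Fin n) (Fin p) ℝ) : Submodule ℝ (EuclideanSpace ℝ (Fin n)) :=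
  LinearMap.range (Matrix.toEuclideanLin X)

/-- The residual and fitted parts of the columns of the standardized data. -/
def components (X : Matrix (Fin n) (Fin p) ℝ) (θ : Param p q) (Y : Sample n q) :
    (Fin q → (colSpace X)ᗮ) × (Fin q → colSpace X) :=
  (fun j ↦ (colSpace X)ᗮ.orthogonalProjectionOnto (columns (standardize X θ Y) j),
    fun j ↦ (colSpace X).orthogonalProjectionOnto (columns (standardize X θ Y) j))

theorem measurePreserving_components (X : Matrix (Fin n) (Fin p) ℝ) (θ : Param p q) :
    MeasurePreserving (components X θ) (law X θ)
      ((stdGaussianFamily (colSpace X)ᗮ q).prod (stdGaussianFamily (colSpace X) q)) := by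
  have h1 : MeasurePreserving
      (fun (z : Fin q → EuclideanSpace ℝ (Fin n)) j ↦
        (((colSpace X)ᗮ.orthogonalProjectionOnto (z j),
          (colSpace X).orthogonalProjectionOnto (z j)) : (colSpace X)ᗮ × colSpace X))
      (stdGaussianFamily (EuclideanSpace ℝ (Fin n)) q)
      (Measure.pi fun _ ↦ (stdGaussian (colSpace X)ᗮ).prod (stdGaussian (colSpace X))) :=
    measurePreserving_pi _ _ fun _ ↦
      ⟨by fun_prop, map_orthogonalProjection_prod_stdGaussian (colSpace X)⟩
  exact (measurePreserving_arrowProdEquivProdArrow (colSpace X)ᗮ (colSpace X) (Fin q) _ _).comp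
    (h1.comp (measurePreserving_columns.comp (measurePreserving_standardize X θ)))

theorem finrank_colSpace {X : Matrix (Fin n) (Fin p) ℝ} (hX : X.rank = p) :
    Module.finrank ℝ (colSpace X) = p := by
  have h := Matrix.rank_eq_finrank_range_toLin X (EuclideanSpace.basisFun (Fin n) ℝ).toBasis
    (EuclideanSpace.basisFun (Fin p) ℝ).toBasis
  rw [← Matrix.toEuclideanLin_eq_toLin_orthonormal, hX] at h
  exact h.symm

theorem finrank_colSpace_orthogonal {X : Matrix (Fin n) (Fin p) ℝ} (hX : X.rank = p) :
    Module.finrank ℝ (colSpace X)ᗮ = n - p := by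
  have h := (colSpace X).finrank_add_finrank_orthogonal
  rw [finrank_colSpace hX, finrank_euclideanSpace_fin] at h
  omega

/-- The hat matrix `X (XᵀX)⁻¹ Xᵀ`. -/
def hatMatrix (X : Matrix (Fin n) (Fin p) ℝ) : Matrix (Fin n) (Fin n) ℝ := X * (Xᵀ * X)⁻¹ * Xᵀ

theorem isUnit_det_transpose_mul_self {X : Matrix (Fin n) (Fin p) ℝ} (hX : X.rank = p) :
    IsUnit (Xᵀ * X).det := by
  rw [← Matrix.isUnit_iff_isUnit_det, ← Matrix.mulVec_surjective_iff_isUnit,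
    ← Matrix.coe_mulVecLin, ← LinearMap.range_eq_top]
  refine Submodule.eq_top_of_finrank_eq ?_
  have h := Matrix.rank_transpose_mul_self X
  rw [hX] at h
  rw [Module.finrank_fin_fun]
  exact h

theorem hatMatrix_mul_self {X : Matrix (Fin n) (Fin p) ℝ} (hX : X.rank = p) :
    hatMatrix X * X = X := by
  rw [hatMatrix, Matrix.mul_assoc, Matrix.mul_assoc,
    Matrix.nonsing_inv_mul _ (isUnit_det_transpose_mul_self hX), Matrix.mul_one]

theorem transpose_hatMatrix (X : Matrix (Fin n) (Fin p) ℝ) : (hatMatrix X)ᵀ = hatMatrix X := by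
  simp [hatMatrix, Matrix.transpose_mul, Matrix.transpose_nonsing_inv, Matrix.mul_assoc]

theorem hatMatrix_mul_hatMatrix {X : Matrix (Fin n) (Fin p) ℝ} (hX : X.rank = p) :
    hatMatrix X * hatMatrix X = hatMatrix X := by
  nth_rw 2 [hatMatrix]
  rw [← Matrix.mul_assoc, ← Matrix.mul_assoc, hatMatrix_mul_self hX, hatMatrix]

/-- The hat matrix maps into the column space and its residual is orthogonal to it, which
characterizes the projection. This ties the matrix formulas for B̂ and Σ̂ to the Gaussian
components. -/
theorem starProjection_colSpace {X : Matrix (Fin n) (Fin p) ℝ} (hX : X.rank = p)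
    (z : EuclideanSpace ℝ (Fin n)) :
    (colSpace X).starProjection z = WithLp.toLp 2 (hatMatrix X *ᵥ z.ofLp) := by
  refine Submodule.eq_starProjection_of_mem_of_inner_eq_zero (K := colSpace X) ?_ ?_
  · exact ⟨WithLp.toLp 2 (((Xᵀ * X)⁻¹ * Xᵀ) *ᵥ z.ofLp), by
      simp [Matrix.toEuclideanLin, hatMatrix, Matrix.mulVec_mulVec, Matrix.mul_assoc]⟩
  · rintro _ ⟨b, rfl⟩
    have h : Xᵀ * hatMatrix X = Xᵀ := by
      conv_lhs => rw [← transpose_hatMatrix, ← Matrix.transpose_mul, hatMatrix_mul_self hX]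
    simp only [EuclideanSpace.inner_eq_star_dotProduct, Matrix.toEuclideanLin, star_trivial]
    change (X *ᵥ b.ofLp) ⬝ᵥ (z.ofLp - hatMatrix X *ᵥ z.ofLp) = 0
    rw [dotProduct_comm, Matrix.dotProduct_mulVec, ← Matrix.mulVec_transpose]
    simp [Matrix.mulVec_sub, Matrix.mulVec_mulVec, h]

theorem inner_orthogonalProjectionOnto {E : Type*} [NormedAddCommGroup E] [InnerProductSpace ℝ E]
    (K : Submodule ℝ E) [K.HasOrthogonalProjection] (x y : E) :
    inner ℝ (K.orthogonalProjectionOnto x) (K.orthogonalProjectionOnto y) =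
      inner ℝ x (K.starProjection y) := by
  rw [Submodule.inner_orthogonalProjectionOnto_eq_of_mem_right]
  rfl

theorem inner_columns_toLp (Z : Sample n q) (M : Matrix (Fin n) (Fin n) ℝ) (j k : Fin q) :
    inner ℝ (columns Z j) (WithLp.toLp 2 (M *ᵥ (columns Z k).ofLp)) =
      ((dataMatrix Z)ᵀ * M * dataMatrix Z) j k := by
  rw [Matrix.mul_assoc, Matrix.mul_apply]
  simp only [PiLp.inner_apply, columns, Matrix.mul_apply, Matrix.mulVec, dotProduct,
    Matrix.transpose_apply, dataMatrix, Matrix.of_apply]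
  exact Finset.sum_congr rfl fun i _ ↦ mul_comm _ _

theorem gram_components_snd {X : Matrix (Fin n) (Fin p) ℝ} (hX : X.rank = p) (θ : Param p q)
    (Y : Sample n q) :
    Matrix.gram ℝ (components X θ Y).2 =
      (dataMatrix (standardize X θ Y))ᵀ * hatMatrix X * dataMatrix (standardize X θ Y) := by
  ext j k
  rw [Matrix.gram_apply, ← inner_columns_toLp, ← starProjection_colSpace hX]
  exact inner_orthogonalProjectionOnto _ _ _

theorem gram_components_fst {X : Matrix (Fin n) (Fin p) ℝ} (hX : X.rank = p) (θ : Param p q)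
    (Y : Sample n q) :
    Matrix.gram ℝ (components X θ Y).1 =
      (dataMatrix (standardize X θ Y))ᵀ * (1 - hatMatrix X) *
        dataMatrix (standardize X θ Y) := by
  ext j k
  have h : (colSpace X)ᗮ.starProjection (columns (standardize X θ Y) k) =
      WithLp.toLp 2 ((1 - hatMatrix X) *ᵥ (columns (standardize X θ Y) k).ofLp) := by
    rw [Submodule.starProjection_orthogonal_val, starProjection_colSpace hX, Matrix.sub_mulVec,
      Matrix.one_mulVec]
    rfl
  rw [Matrix.gram_apply, ← inner_columns_toLp, ← h]
  exact inner_orthogonalProjectionOnto _ _ _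

end MVRegression

/-! ### Σ̂, the likelihood and the discrepancy in terms of the components. -/

namespace MVRegression

open scoped MatrixOrder

variable {n p q : ℕ}

theorem rowMean_apply (X : Matrix (Fin n) (Fin p) ℝ) (B : Matrix (Fin p) (Fin q) ℝ) (i : Fin n)
    (j : Fin q) : rowMean X B i j = (X * B) i j := by
  simp [rowMean, Matrix.mulVec, dotProduct, Matrix.mul_apply, mul_comm]

theorem transpose_inv_sqrt (S : Matrix (Fin q) (Fin q) ℝ) :
    ((CFC.sqrt S)⁻¹)ᵀ = (CFC.sqrt S)⁻¹ := by
  rw [Matrix.transpose_nonsing_inv, transpose_sqrt]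

theorem dataMatrix_standardize (X : Matrix (Fin n) (Fin p) ℝ) (θ : Param p q) (Y : Sample n q) :
    dataMatrix (standardize X θ Y) = (dataMatrix Y - X * θ.1) * (CFC.sqrt θ.2.1)⁻¹ := by
  ext i j
  have h := fun k ↦ congrFun (congrFun (transpose_inv_sqrt θ.2.1) k) j
  rw [Matrix.mul_apply]
  change ((CFC.sqrt θ.2.1)⁻¹ *ᵥ (Y i - rowMean X θ.1 i).ofLp) j = _
  rw [Matrix.mulVec, dotProduct]
  refine Finset.sum_congr rfl fun k _ ↦ ?_
  rw [← h k, Matrix.transpose_apply, mul_comm]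
  simp [dataMatrix, rowMean_apply]

theorem dataMatrix_eq (X : Matrix (Fin n) (Fin p) ℝ) (θ : Param p q) (Y : Sample n q) :
    dataMatrix Y = X * θ.1 + dataMatrix (standardize X θ Y) * CFC.sqrt θ.2.1 := by
  rw [dataMatrix_standardize, Matrix.nonsing_inv_mul_cancel_right _ _ (isUnit_det_sqrt θ.2.2)]
  abel

theorem mul_Bhat (X : Matrix (Fin n) (Fin p) ℝ) (Y : Sample n q) :
    X * Bhat X Y = hatMatrix X * dataMatrix Y := by
  simp only [Bhat, hatMatrix, Matrix.mul_assoc]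

theorem residual_eq {X : Matrix (Fin n) (Fin p) ℝ} (hX : X.rank = p) (θ : Param p q)
    (Y : Sample n q) :
    dataMatrix Y - X * Bhat X Y =
      (1 - hatMatrix X) * dataMatrix (standardize X θ Y) * CFC.sqrt θ.2.1 := by
  rw [mul_Bhat, dataMatrix_eq X θ Y, Matrix.mul_add, ← Matrix.mul_assoc, hatMatrix_mul_self hX]
  simp only [Matrix.sub_mul, Matrix.one_mul, Matrix.mul_assoc]
  abel

theorem fitted_sub_eq {X : Matrix (Fin n) (Fin p) ℝ} (hX : X.rank = p) (θ : Param p q)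
    (Y : Sample n q) :
    X * θ.1 - X * Bhat X Y =
      -(hatMatrix X * dataMatrix (standardize X θ Y) * CFC.sqrt θ.2.1) := by
  rw [mul_Bhat, dataMatrix_eq X θ Y, Matrix.mul_add, ← Matrix.mul_assoc, hatMatrix_mul_self hX]
  simp only [Matrix.mul_assoc]
  abel

/-- Residuals annihilate XB, and 1 − H is a symmetric idempotent for the hat matrix H, so Σ enters
only through the outer factors Σ^(1/2). -/
theorem Sigmahat_eq {X : Matrix (Fin n) (Fin p) ℝ} (hX : X.rank = p) (θ : Param p q)
    (Y : Sample n q) :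
    Sigmahat X Y = (n : ℝ)⁻¹ •
      (CFC.sqrt θ.2.1 * Matrix.gram ℝ (components X θ Y).1 * CFC.sqrt θ.2.1) := by
  have h : (1 - hatMatrix X) * (1 - hatMatrix X) = 1 - hatMatrix X := by
    have h0 := hatMatrix_mul_hatMatrix hX
    rw [Matrix.mul_sub, Matrix.sub_mul, Matrix.sub_mul, h0]
    simp
  rw [Sigmahat, residual_eq hX θ, gram_components_fst hX]
  congr 1
  simp only [Matrix.transpose_mul, transpose_sqrt, Matrix.transpose_sub, Matrix.transpose_one,
    transpose_hatMatrix]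
  conv_rhs => rw [← h]
  simp only [Matrix.mul_assoc]

theorem transpose_fitted_sub_mul_self {X : Matrix (Fin n) (Fin p) ℝ} (hX : X.rank = p)
    (θ : Param p q) (Y : Sample n q) :
    (X * θ.1 - X * Bhat X Y)ᵀ * (X * θ.1 - X * Bhat X Y) =
      CFC.sqrt θ.2.1 * Matrix.gram ℝ (components X θ Y).2 * CFC.sqrt θ.2.1 := by
  rw [fitted_sub_eq hX θ, gram_components_snd hX]
  simp only [Matrix.transpose_neg, Matrix.transpose_mul, transpose_sqrt, transpose_hatMatrix]
  conv_rhs => rw [← hatMatrix_mul_hatMatrix hX]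
  simp only [Matrix.mul_assoc, Matrix.neg_mul, Matrix.mul_neg, neg_neg]

theorem det_Sigmahat {X : Matrix (Fin n) (Fin p) ℝ} (hX : X.rank = p) (θ : Param p q)
    (Y : Sample n q) :
    (Sigmahat X Y).det =
      ((n : ℝ)⁻¹) ^ q * (θ.2.1.det * (Matrix.gram ℝ (components X θ Y).1).det) := by
  rw [Sigmahat_eq hX θ, Matrix.det_smul, Fintype.card_fin, Matrix.det_mul, Matrix.det_mul]
  conv_rhs => rw [← sqrt_mul_sqrt θ.2.2, Matrix.det_mul]
  ring

theorem posDef_Sigmahat (hn : 0 < n) {X : Matrix (Fin n) (Fin p) ℝ} (hX : X.rank = p)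
    (θ : Param p q) {Y : Sample n q} (hY : LinearIndependent ℝ (components X θ Y).1) :
    (Sigmahat X Y).PosDef := by
  have hpsd : (Sigmahat X Y).PosSemidef := by
    rw [Sigmahat, ← Matrix.conjTranspose_eq_transpose_of_trivial]
    exact (Matrix.posSemidef_conjTranspose_mul_self _).smul (by positivity)
  rw [hpsd.posDef_iff_det_ne_zero, det_Sigmahat hX θ]
  have := θ.2.2.det_pos
  have := Matrix.det_gram_ne_zero_iff_linearIndependent.2 hY
  have : (n : ℝ) ≠ 0 := by positivity
  positivity

theorem log_det_Sigmahat (hn : 0 < n) {X : Matrix (Fin n) (Fin p) ℝ} (hX : X.rank = p)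
    (θ : Param p q) {Y : Sample n q} (hY : LinearIndependent ℝ (components X θ Y).1) :
    Real.log (Sigmahat X Y).det = Real.log (Matrix.gram ℝ (components X θ Y).1).det +
      (Real.log θ.2.1.det - q * Real.log n) := by
  have h1 := θ.2.2.det_pos
  have h2 := Matrix.det_gram_ne_zero_iff_linearIndependent.2 hY
  have h3 : (n : ℝ) ≠ 0 := by positivity
  rw [det_Sigmahat hX θ, Real.log_mul (by positivity) (by positivity),
    Real.log_mul h1.ne' h2, Real.log_pow, Real.log_inv]
  ring

theorem inv_Sigmahat (hn : 0 < n) {X : Matrix (Fin n) (Fin p) ℝ} (hX : X.rank = p)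
    (θ : Param p q) {Y : Sample n q} (hY : LinearIndependent ℝ (components X θ Y).1) :
    (Sigmahat X Y)⁻¹ = (n : ℝ) • ((CFC.sqrt θ.2.1)⁻¹ *
      (Matrix.gram ℝ (components X θ Y).1)⁻¹ * (CFC.sqrt θ.2.1)⁻¹) := by
  have h3 : (n : ℝ) ≠ 0 := by positivity
  have hR := isUnit_det_sqrt θ.2.2
  have hW := (Matrix.det_gram_ne_zero_iff_linearIndependent.2 hY).isUnit
  have := invertibleOfNonzero (inv_ne_zero h3)
  rw [Sigmahat_eq hX θ, Matrix.inv_smul _ _ (by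
    rw [Matrix.det_mul, Matrix.det_mul]; exact (hR.mul hW).mul hR), Matrix.mul_inv_rev,
    Matrix.mul_inv_rev, invOf_eq_inv, inv_inv, Matrix.mul_assoc]

/-- Cyclicity of the trace cancels the factors Σ^(1/2): this is what frees the loss from Σ. -/
theorem trace_inv_Sigmahat_mul (hn : 0 < n) {X : Matrix (Fin n) (Fin p) ℝ} (hX : X.rank = p)
    (θ : Param p q) {Y : Sample n q} (hY : LinearIndependent ℝ (components X θ Y).1)
    (M : Matrix (Fin q) (Fin q) ℝ) :
    ((Sigmahat X Y)⁻¹ * (CFC.sqrt θ.2.1 * M * CFC.sqrt θ.2.1)).trace =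
      n * ((Matrix.gram ℝ (components X θ Y).1)⁻¹ * M).trace := by
  have hR := isUnit_det_sqrt θ.2.2
  rw [inv_Sigmahat hn hX θ hY, Matrix.smul_mul, Matrix.trace_smul, smul_eq_mul]
  congr 1
  rw [Matrix.mul_assoc, Matrix.mul_assoc, Matrix.mul_assoc, Matrix.trace_mul_comm,
    Matrix.nonsing_inv_mul_cancel_left _ _ hR, Matrix.mul_assoc, Matrix.mul_assoc,
    Matrix.mul_nonsing_inv _ hR, Matrix.mul_one]

theorem log_gaussianDensity {S : Matrix (Fin q) (Fin q) ℝ} (hS : S.PosDef)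
    (μ y : EuclideanSpace ℝ (Fin q)) :
    Real.log (gaussianDensity μ S y) = -(1 / 2) * (q * Real.log (2 * Real.pi) +
      Real.log S.det + (y - μ).ofLp ⬝ᵥ (S⁻¹ *ᵥ (y - μ).ofLp)) := by
  have h1 := hS.det_pos
  have h2 : 0 < 2 * Real.pi := by positivity
  have h3 : (2 * Real.pi) ^ (-(q : ℝ) / 2) ≠ 0 := (Real.rpow_pos_of_pos h2 _).ne'
  have h4 : S.det ^ (-(1 : ℝ) / 2) ≠ 0 := (Real.rpow_pos_of_pos h1 _).ne'
  rw [gaussianDensity, Real.log_mul (mul_ne_zero h3 h4) (Real.exp_pos _).ne',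
    Real.log_mul h3 h4, Real.log_rpow h2, Real.log_rpow h1, Real.log_exp]
  ring

theorem gaussianDensity_pos {S : Matrix (Fin q) (Fin q) ℝ} (hS : S.PosDef)
    (μ y : EuclideanSpace ℝ (Fin q)) : 0 < gaussianDensity μ S y := by
  have := hS.det_pos
  unfold gaussianDensity
  positivity

theorem neg_two_mul_log_density (X : Matrix (Fin n) (Fin p) ℝ) (B : Matrix (Fin p) (Fin q) ℝ)
    {S : Matrix (Fin q) (Fin q) ℝ} (hS : S.PosDef) (Y : Sample n q) :
    -2 * Real.log (density X B S Y) = n * (q * Real.log (2 * Real.pi) + Real.log S.det) +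
      ∑ i, (Y i - rowMean X B i).ofLp ⬝ᵥ (S⁻¹ *ᵥ (Y i - rowMean X B i).ofLp) := by
  rw [density, Real.log_prod fun i _ ↦ (gaussianDensity_pos hS _ _).ne', Finset.mul_sum]
  simp_rw [log_gaussianDensity hS]
  rw [show (n : ℝ) * (q * Real.log (2 * Real.pi) + Real.log S.det) =
    ∑ _i : Fin n, (q * Real.log (2 * Real.pi) + Real.log S.det) by simp [mul_add], ← Finset.sum_add_distrib]
  refine Finset.sum_congr rfl fun i _ ↦ ?_
  ring

theorem trace_mul_transpose_mul_self (A : Matrix (Fin q) (Fin q) ℝ)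
    (D : Matrix (Fin n) (Fin q) ℝ) : (A * (Dᵀ * D)).trace = ∑ i, D i ⬝ᵥ (A *ᵥ D i) := by
  rw [← Matrix.mul_assoc, Matrix.trace_mul_comm, Matrix.trace]
  refine Finset.sum_congr rfl fun i _ ↦ ?_
  rw [Matrix.diag_apply, Matrix.mul_apply, dotProduct]
  refine Finset.sum_congr rfl fun j _ ↦ ?_
  rw [Matrix.mul_apply, Matrix.mulVec, dotProduct]
  rfl

/-- The residual cross-product is nΣ̂ by definition, so the quadratic form totals n tr I = nq. -/
theorem neg_two_mul_log_density_mle (hn : 0 < n) {X : Matrix (Fin n) (Fin p) ℝ} {Y : Sample n q}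
    (hS : (Sigmahat X Y).PosDef) :
    -2 * Real.log (density X (Bhat X Y) (Sigmahat X Y) Y) =
      n * (q * Real.log (2 * Real.pi) + Real.log (Sigmahat X Y).det) + n * q := by
  have h3 : (n : ℝ) ≠ 0 := by positivity
  have hD : ∀ i, (Y i - rowMean X (Bhat X Y) i).ofLp = (dataMatrix Y - X * Bhat X Y) i := by
    intro i
    ext j
    simp [rowMean_apply, dataMatrix]
  have hR : (dataMatrix Y - X * Bhat X Y)ᵀ * (dataMatrix Y - X * Bhat X Y) =
      (n : ℝ) • Sigmahat X Y := by
    rw [Sigmahat, smul_inv_smul₀ h3]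
  rw [neg_two_mul_log_density X _ hS]
  simp_rw [hD]
  rw [← trace_mul_transpose_mul_self, hR, Matrix.mul_smul,
    Matrix.nonsing_inv_mul _ hS.det_pos.ne'.isUnit, Matrix.trace_smul, Matrix.trace_one]
  simp

theorem memLp_two_sub_apply_multivariateGaussian (μ b : EuclideanSpace ℝ (Fin q))
    (S : Matrix (Fin q) (Fin q) ℝ) (j : Fin q) :
    MemLp (fun y ↦ (y - b) j) 2 (multivariateGaussian μ S) :=
  ((EuclideanSpace.proj (𝕜 := ℝ) j).comp_memLp' IsGaussian.memLp_two_id).sub (memLp_const (b j))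

theorem integral_sub_mul_sub_multivariateGaussian {S : Matrix (Fin q) (Fin q) ℝ}
    (hS : S.PosSemidef) (μ b : EuclideanSpace ℝ (Fin q)) (j k : Fin q) :
    ∫ y, (y - b) j * (y - b) k ∂(multivariateGaussian μ S) =
      S j k + (μ - b) j * (μ - b) k := by
  have hmem := memLp_two_sub_apply_multivariateGaussian μ b S
  have hmem0 : ∀ j : Fin q, Integrable (fun y : EuclideanSpace ℝ (Fin q) ↦ y j)
      (multivariateGaussian μ S) := fun j ↦ by
    simpa using (memLp_two_sub_apply_multivariateGaussian μ 0 S j).integrable one_le_two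
  have hmean : ∀ j : Fin q, ∫ y, (y - b) j ∂(multivariateGaussian μ S) = (μ - b) j := by
    intro j
    have h := (EuclideanSpace.proj (𝕜 := ℝ) j).integral_comp_comm
      (IsGaussian.integrable_id (μ := multivariateGaussian μ S))
    simp only [EuclideanSpace.coe_proj, id_eq, integral_id_multivariateGaussian] at h
    simp only [PiLp.sub_apply]
    rw [integral_sub (hmem0 j) (integrable_const _), h]
    simp
  have h := covariance_eq_sub (hmem j) (hmem k)
  simp only [Pi.mul_apply, hmean] at h
  have hc := covariance_eval_multivariateGaussian (μ := μ) hS j k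
  rw [← covariance_sub_const_left (hmem0 j) (b j), ← covariance_sub_const_right (hmem0 k) (b k)]
    at hc
  simp only [PiLp.sub_apply] at h hc ⊢
  linarith

theorem integrable_quadForm_multivariateGaussian (A S : Matrix (Fin q) (Fin q) ℝ)
    (μ b : EuclideanSpace ℝ (Fin q)) :
    Integrable (fun y : EuclideanSpace ℝ (Fin q) ↦ (y - b).ofLp ⬝ᵥ (A *ᵥ (y - b).ofLp))
      (multivariateGaussian μ S) := by
  simp only [dotProduct, Matrix.mulVec, Finset.mul_sum]
  refine integrable_finsetSum _ fun j _ ↦ integrable_finsetSum _ fun k _ ↦ ?_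
  refine (((memLp_two_sub_apply_multivariateGaussian μ b S j).integrable_mul
    (memLp_two_sub_apply_multivariateGaussian μ b S k)).const_mul (A j k)).congr
    (.of_forall fun y ↦ ?_)
  simp only [Pi.mul_apply]
  ring

theorem integral_quadForm_multivariateGaussian (A : Matrix (Fin q) (Fin q) ℝ)
    {S : Matrix (Fin q) (Fin q) ℝ} (hS : S.PosSemidef) (μ b : EuclideanSpace ℝ (Fin q)) :
    ∫ y, (y - b).ofLp ⬝ᵥ (A *ᵥ (y - b).ofLp) ∂(multivariateGaussian μ S) =
      (A * S).trace + (μ - b).ofLp ⬝ᵥ (A *ᵥ (μ - b).ofLp) := by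
  have hterm : ∀ (j k : Fin q), Integrable (fun y : EuclideanSpace ℝ (Fin q) ↦
      A j k * ((y - b) j * (y - b) k)) (multivariateGaussian μ S) := fun j k ↦
    ((memLp_two_sub_apply_multivariateGaussian μ b S j).integrable_mul
      (memLp_two_sub_apply_multivariateGaussian μ b S k)).const_mul (A j k)
  have hquad : ∀ y : EuclideanSpace ℝ (Fin q), y.ofLp ⬝ᵥ (A *ᵥ y.ofLp) =
      ∑ j, ∑ k, A j k * (y j * y k) := by
    intro y
    simp only [dotProduct, Matrix.mulVec, Finset.mul_sum]
    exact Finset.sum_congr rfl fun j _ ↦ Finset.sum_congr rfl fun k _ ↦ by ring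
  simp_rw [hquad]
  rw [integral_finsetSum _ fun j _ ↦ integrable_finsetSum _ fun k _ ↦ hterm j k]
  simp_rw [integral_finsetSum _ fun k _ ↦ hterm _ k, integral_const_mul,
    integral_sub_mul_sub_multivariateGaussian hS, mul_add, Finset.sum_add_distrib]
  congr 1
  have hsymm : ∀ j k, S j k = S k j := fun j k ↦ by simpa using (hS.1.apply j k).symm
  simp only [Matrix.trace, Matrix.diag_apply, Matrix.mul_apply]
  exact Finset.sum_congr rfl fun j _ ↦ Finset.sum_congr rfl fun k _ ↦ by rw [hsymm]

/-- Each row contributes the expected quadratic form of a shifted Gaussian, a covariance trace plus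
the form at the mean error. -/
theorem neg_two_mul_integral_log_density (X : Matrix (Fin n) (Fin p) ℝ) (θ : Param p q)
    (B : Matrix (Fin p) (Fin q) ℝ) {S : Matrix (Fin q) (Fin q) ℝ} (hS : S.PosDef) :
    -2 * ∫ Y, Real.log (density X B S Y) ∂(law X θ) =
      n * (q * Real.log (2 * Real.pi) + Real.log S.det) + n * (S⁻¹ * θ.2.1).trace +
        (S⁻¹ * ((X * θ.1 - X * B)ᵀ * (X * θ.1 - X * B))).trace := by
  have hprob : IsProbabilityMeasure (law X θ) := by
    unfold law
    infer_instance
  have hint : ∀ i, Integrable (fun Y : Sample n q ↦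
      (Y i - rowMean X B i).ofLp ⬝ᵥ (S⁻¹ *ᵥ (Y i - rowMean X B i).ofLp)) (law X θ) := fun i ↦
    integrable_comp_eval (μ := fun i ↦ multivariateGaussian (rowMean X θ.1 i) θ.2.1) (i := i)
      (integrable_quadForm_multivariateGaussian S⁻¹ θ.2.1 _ (rowMean X B i))
  have hval : ∀ i, ∫ Y, (Y i - rowMean X B i).ofLp ⬝ᵥ (S⁻¹ *ᵥ (Y i - rowMean X B i).ofLp)
      ∂(law X θ) = (S⁻¹ * θ.2.1).trace +
        (X * θ.1 - X * B) i ⬝ᵥ (S⁻¹ *ᵥ (X * θ.1 - X * B) i) := by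
    intro i
    have h := integral_comp_eval
      (μ := fun i ↦ multivariateGaussian (rowMean X θ.1 i) θ.2.1) (i := i)
      (integrable_quadForm_multivariateGaussian S⁻¹ θ.2.1 (rowMean X θ.1 i)
        (rowMean X B i)).aestronglyMeasurable
    rw [integral_quadForm_multivariateGaussian S⁻¹ θ.2.2.posSemidef] at h
    have hD : (rowMean X θ.1 i - rowMean X B i).ofLp = (X * θ.1 - X * B) i := by
      ext j
      simp [rowMean_apply]
    rw [hD] at h
    exact h
  rw [← integral_const_mul]
  simp_rw [neg_two_mul_log_density X B hS]
  rw [integral_add (integrable_const _) (integrable_finsetSum _ fun i _ ↦ hint i),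
    integral_finsetSum _ fun i _ ↦ hint i]
  simp_rw [hval]
  rw [trace_mul_transpose_mul_self, Finset.sum_add_distrib]
  simp [add_assoc]

theorem klDiscrepancy_eq (hn : 0 < n) {X : Matrix (Fin n) (Fin p) ℝ} (hX : X.rank = p)
    (θ : Param p q) {Y : Sample n q} (hY : LinearIndependent ℝ (components X θ Y).1) :
    klDiscrepancy X θ Y =
      n * (q * Real.log (2 * Real.pi) + Real.log (Sigmahat X Y).det) +
        (n ^ 2 * (Matrix.gram ℝ (components X θ Y).1)⁻¹.trace +
        n * ((Matrix.gram ℝ (components X θ Y).1)⁻¹ *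
          Matrix.gram ℝ (components X θ Y).2).trace) := by
  -- With M = 1 the sandwiched matrix is Σ itself, so n tr(Σ̂⁻¹Σ) becomes n² tr W⁻¹.
  have h1 := trace_inv_Sigmahat_mul hn hX θ hY 1
  rw [Matrix.mul_one, Matrix.mul_one, sqrt_mul_sqrt θ.2.2] at h1
  rw [klDiscrepancy, neg_two_mul_integral_log_density X θ _ (posDef_Sigmahat hn hX θ hY), h1,
    transpose_fitted_sub_mul_self hX, trace_inv_Sigmahat_mul hn hX θ hY]
  ring

end MVRegression

/-! ### Mean squared error of a centred variable under a constant shift. -/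

namespace LossEstimation

variable {Ω : Type*} [MeasurableSpace Ω] {P : Measure Ω} [IsProbabilityMeasure P] {f : Ω → ℝ}

theorem integral_sub_const_sq (hf : MemLp f 2 P) (h0 : ∫ ω, f ω ∂P = 0) (c : ℝ) :
    ∫ ω, (f ω - c) ^ 2 ∂P = ∫ ω, f ω ^ 2 ∂P + c ^ 2 := by
  have h1 := hf.integrable_sq
  have h2 := (hf.integrable one_le_two).const_mul (-2 * c)
  have h : ∀ ω, (f ω - c) ^ 2 = f ω ^ 2 + (-2 * c * f ω + c ^ 2) := fun ω ↦ by ring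
  simp_rw [h]
  have h3 : Integrable (fun ω ↦ -2 * c * f ω + c ^ 2) P := h2.add (integrable_const _)
  rw [integral_add h1 h3, integral_add h2 (integrable_const _), integral_const_mul, h0]
  simp

omit [IsProbabilityMeasure P] in
theorem lintegral_sq_eq_ofReal (hf : MemLp f 2 P) :
    ∫⁻ ω, ENNReal.ofReal (f ω ^ 2) ∂P = ENNReal.ofReal (∫ ω, f ω ^ 2 ∂P) :=
  (ofReal_integral_eq_lintegral_ofReal hf.integrable_sq (.of_forall fun _ ↦ sq_nonneg _)).symm

theorem lintegral_sq_le_lintegral_sub_const_sq (hf : Integrable f P) (h0 : ∫ ω, f ω ∂P = 0)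
    (c : ℝ) :
    ∫⁻ ω, ENNReal.ofReal (f ω ^ 2) ∂P ≤ ∫⁻ ω, ENNReal.ofReal ((f ω - c) ^ 2) ∂P := by
  have hm : AEStronglyMeasurable (fun ω ↦ f ω - c) P := by
    have := hf.aestronglyMeasurable
    fun_prop
  -- If the shifted error is infinite there is nothing to prove; otherwise f − c, and hence f, is
  -- square integrable.
  by_cases htop : ∫⁻ ω, ENNReal.ofReal ((f ω - c) ^ 2) ∂P = ∞
  · rw [htop]
    exact le_top
  have h2 : MemLp (fun ω ↦ f ω - c) 2 P := by
    rw [memLp_two_iff_integrable_sq hm]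
    exact (lintegral_ofReal_ne_top_iff_integrable (hm.pow 2)
      (.of_forall fun _ ↦ sq_nonneg _)).1 htop
  have hf2 : MemLp f 2 P :=
    (memLp_congr_ae (.of_forall fun ω ↦ by simp)).1 (h2.add (memLp_const c))
  rw [lintegral_sq_eq_ofReal hf2, lintegral_sq_eq_ofReal h2, integral_sub_const_sq hf2 h0]
  exact ENNReal.ofReal_le_ofReal (by nlinarith [sq_nonneg c])

end LossEstimation

/-! ### Integrability, unbiasedness and measurability of AICc. -/

namespace MVRegression

variable {n p q : ℕ}

instance isProbabilityMeasure_law (X : Matrix (Fin n) (Fin p) ℝ) (θ : Param p q) :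
    IsProbabilityMeasure (law X θ) := by
  unfold law
  infer_instance

/-- The part of the Kullback--Leibler discrepancy that is not a function of `det Σ̂`, in terms of
the components of the standardized data. -/
def traceLoss (X : Matrix (Fin n) (Fin p) ℝ) (w : (Fin q → (colSpace X)ᗮ) × (Fin q → colSpace X)) :
    ℝ :=
  n ^ 2 * (Matrix.gram ℝ w.1)⁻¹.trace + n * ((Matrix.gram ℝ w.1)⁻¹ * Matrix.gram ℝ w.2).trace

section

variable {X : Matrix (Fin n) (Fin p) ℝ} (hX : X.rank = p)
include hX

theorem ae_linearIndependent_components (hn : p + q ≤ n) (θ : Param p q) :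
    ∀ᵐ Y ∂(law X θ), LinearIndependent ℝ (components X θ Y).1 := by
  have h := ae_linearIndependent_pi_stdGaussian (E := (colSpace X)ᗮ) (q := q)
    (by rw [finrank_colSpace_orthogonal hX]; omega)
  exact (measurePreserving_components X θ).quasiMeasurePreserving.ae
    (Measure.quasiMeasurePreserving_fst.ae h)

theorem AICc_ae_eq (hn : p + q + 1 < n) (θ : Param p q) :
    ∃ c : ℝ, AICc X =ᵐ[law X θ] fun Y ↦
      n * Real.log (Matrix.gram ℝ (components X θ Y).1).det + c := by
  refine ⟨n * (q * Real.log (2 * Real.pi) + (Real.log θ.2.1.det - q * Real.log n)) + n * q +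
    2 * (n : ℝ) / ((n : ℝ) - p - q - 1) * numParams p q, ?_⟩
  filter_upwards [ae_linearIndependent_components hX (by omega) θ] with Y hY
  rw [AICc, neg_two_mul_log_density_mle (by omega) (posDef_Sigmahat (by omega) hX θ hY),
    log_det_Sigmahat (by omega) hX θ hY]
  ring

/-- The n log det Σ̂ terms cancel, so only a constant and the parameter-free trace loss remain. -/
theorem AICc_sub_klDiscrepancy_ae_eq (hn : p + q + 1 < n) (θ : Param p q) :
    (fun Y ↦ AICc X Y - klDiscrepancy X θ Y) =ᵐ[law X θ] fun Y ↦
      (n * q + 2 * (n : ℝ) / ((n : ℝ) - p - q - 1) * numParams p q) -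
        traceLoss X (components X θ Y) := by
  filter_upwards [ae_linearIndependent_components hX (by omega) θ] with Y hY
  rw [AICc, neg_two_mul_log_density_mle (by omega) (posDef_Sigmahat (by omega) hX θ hY),
    klDiscrepancy_eq (by omega) hX θ hY, traceLoss]
  ring

theorem integrable_AICc (hn : p + q + 1 < n) (θ : Param p q) :
    Integrable (AICc X) (law X θ) := by
  obtain ⟨c, hc⟩ := AICc_ae_eq hX hn θ
  have h := (measurePreserving_components X θ).integrable_comp_of_integrable
    (Integrable.comp_fst (integrable_log_det_gram (E := (colSpace X)ᗮ) (q := q)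
      (by rw [finrank_colSpace_orthogonal hX]; omega)) (stdGaussianFamily (colSpace X) q))
  exact ((h.const_mul (n : ℝ)).add (integrable_const c)).congr hc.symm

theorem integrable_traceLoss (hn : p + q + 1 < n) :
    Integrable (traceLoss (q := q) X)
      ((stdGaussianFamily (colSpace X)ᗮ q).prod (stdGaussianFamily (colSpace X) q)) := by
  have hr : q + 1 < Module.finrank ℝ (colSpace X)ᗮ := by
    rw [finrank_colSpace_orthogonal hX]
    omega
  have h1 : Integrable (fun z : Fin q → (colSpace X)ᗮ ↦ (Matrix.gram ℝ z)⁻¹.trace)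
      (stdGaussianFamily (colSpace X)ᗮ q) :=
    integrable_finsetSum _ fun j _ ↦ integrable_inv_gram_apply_self hr j
  exact ((Integrable.comp_fst h1 _).const_mul _).add
    ((integrable_trace_inv_gram_mul_gram hr).const_mul _)

/-- With m = n − p − q − 1 the two traces average q/m and pq/m, giving nq(n + p)/m. Writing n + p =
m + (2p + q + 1) and q(2p + q + 1) = 2k produces the AICc penalty. -/
theorem integral_traceLoss (hn : p + q + 1 < n) :
    ∫ w, traceLoss (q := q) X w
      ∂((stdGaussianFamily (colSpace X)ᗮ q).prod (stdGaussianFamily (colSpace X) q)) =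
    n * q + 2 * (n : ℝ) / ((n : ℝ) - p - q - 1) * numParams p q := by
  have hr : q + 1 < Module.finrank ℝ (colSpace X)ᗮ := by
    rw [finrank_colSpace_orthogonal hX]
    omega
  have h1 : Integrable (fun z : Fin q → (colSpace X)ᗮ ↦ (Matrix.gram ℝ z)⁻¹.trace)
      (stdGaussianFamily (colSpace X)ᗮ q) :=
    integrable_finsetSum _ fun j _ ↦ integrable_inv_gram_apply_self hr j
  have h2 : ∫ z : Fin q → (colSpace X)ᗮ, (Matrix.gram ℝ z)⁻¹.trace
      ∂(stdGaussianFamily (colSpace X)ᗮ q) = q / ((n : ℝ) - p - q - 1) := by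
    simp only [Matrix.trace, Matrix.diag_apply]
    rw [integral_finsetSum _ fun j _ ↦ integrable_inv_gram_apply_self hr j]
    simp_rw [integral_inv_gram_apply_self hr, finrank_colSpace_orthogonal hX]
    rw [Nat.cast_sub (by omega)]
    simp [div_eq_mul_inv]
  unfold traceLoss
  rw [integral_add ((Integrable.comp_fst h1 _).const_mul _)
    ((integrable_trace_inv_gram_mul_gram hr).const_mul _), integral_const_mul, integral_const_mul,
    integral_fun_fst (μ := stdGaussianFamily (colSpace X)ᗮ q)
      (f := fun z ↦ (Matrix.gram ℝ z)⁻¹.trace), h2, integral_trace_inv_gram_mul_gram hr,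
    finrank_colSpace_orthogonal hX, finrank_colSpace hX, Nat.cast_sub (by omega), numParams]
  have : (p : ℝ) + q + 1 < n := by exact_mod_cast hn
  have : (n : ℝ) - p - q - 1 ≠ 0 := by linarith
  simp
  field_simp
  ring

theorem integrable_AICc_sub_klDiscrepancy (hn : p + q + 1 < n) (θ : Param p q) :
    Integrable (fun Y ↦ AICc X Y - klDiscrepancy X θ Y) (law X θ) :=
  ((integrable_const _).sub ((measurePreserving_components X θ).integrable_comp_of_integrable
    (integrable_traceLoss hX hn))).congr (AICc_sub_klDiscrepancy_ae_eq hX hn θ).symm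

theorem integral_AICc_sub_klDiscrepancy (hn : p + q + 1 < n) (θ : Param p q) :
    ∫ Y, (AICc X Y - klDiscrepancy X θ Y) ∂(law X θ) = 0 := by
  have hmp := measurePreserving_components X θ
  have hint := integrable_traceLoss (q := q) hX hn
  have h := integral_map (μ := law X θ) hmp.measurable.aemeasurable (f := traceLoss X)
    (by rw [hmp.map_eq]; exact hint.aestronglyMeasurable)
  rw [hmp.map_eq, integral_traceLoss hX hn] at h
  have hcomp : Integrable (fun Y ↦ traceLoss X (components X θ Y)) (law X θ) :=
    hmp.integrable_comp_of_integrable hint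
  rw [integral_congr_ae (AICc_sub_klDiscrepancy_ae_eq hX hn θ),
    integral_sub (integrable_const _) hcomp, ← h]
  simp

theorem integrable_klDiscrepancy (hn : p + q + 1 < n) (θ : Param p q) :
    Integrable (klDiscrepancy X θ) (law X θ) :=
  ((integrable_AICc hX hn θ).sub (integrable_AICc_sub_klDiscrepancy hX hn θ)).congr
    (.of_forall fun Y ↦ by simp)

theorem memLp_two_AICc_sub_klDiscrepancy (hn : p + q + 3 < n) (θ : Param p q) :
    MemLp (fun Y ↦ AICc X Y - klDiscrepancy X θ Y) 2 (law X θ) := by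
  have hr : q + 3 < Module.finrank ℝ (colSpace X)ᗮ := by
    rw [finrank_colSpace_orthogonal hX]
    omega
  have h1 : MemLp (fun z : Fin q → (colSpace X)ᗮ ↦ (Matrix.gram ℝ z)⁻¹.trace) 2
      (stdGaussianFamily (colSpace X)ᗮ q) :=
    memLp_finsetSum _ fun j _ ↦ memLp_two_inv_gram_apply_self hr j
  have h2 : MemLp (traceLoss (q := q) X) 2
      ((stdGaussianFamily (colSpace X)ᗮ q).prod (stdGaussianFamily (colSpace X) q)) :=
    ((h1.comp_measurePreserving measurePreserving_fst).const_mul _).add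
      ((memLp_two_trace_inv_gram_mul_gram hr).const_mul _)
  exact (memLp_congr_ae (AICc_sub_klDiscrepancy_ae_eq hX (by omega) θ)).2
    ((memLp_const _).sub (h2.comp_measurePreserving (measurePreserving_components X θ)))

end

theorem measurable_matrix_mul_apply {α : Type*} [MeasurableSpace α] {l m r : ℕ}
    {M : α → Matrix (Fin l) (Fin m) ℝ} {N : α → Matrix (Fin m) (Fin r) ℝ}
    (hM : ∀ i j, Measurable fun a ↦ M a i j) (hN : ∀ i j, Measurable fun a ↦ N a i j)
    (i : Fin l) (j : Fin r) : Measurable fun a ↦ (M a * N a) i j := by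
  simp only [Matrix.mul_apply]
  fun_prop

theorem measurable_dataMatrix_apply (i : Fin n) (j : Fin q) :
    Measurable fun Y : Sample n q ↦ dataMatrix Y i j := by
  simp only [dataMatrix, Matrix.of_apply]
  fun_prop

theorem measurable_mul_Bhat_apply (X : Matrix (Fin n) (Fin p) ℝ) (i : Fin n) (j : Fin q) :
    Measurable fun Y : Sample n q ↦ (X * Bhat X Y) i j :=
  measurable_matrix_mul_apply (M := fun _ ↦ X) (fun _ _ ↦ measurable_const)
    (measurable_matrix_mul_apply (M := fun _ ↦ (Xᵀ * X)⁻¹ * Xᵀ) (fun _ _ ↦ measurable_const)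
      measurable_dataMatrix_apply) i j

theorem measurable_Sigmahat_apply (X : Matrix (Fin n) (Fin p) ℝ) (i j : Fin q) :
    Measurable fun Y : Sample n q ↦ Sigmahat X Y i j := by
  have h : ∀ i j, Measurable fun Y : Sample n q ↦ (dataMatrix Y - X * Bhat X Y) i j :=
    fun i j ↦ (measurable_dataMatrix_apply i j).sub (measurable_mul_Bhat_apply X i j)
  exact (measurable_matrix_mul_apply (fun i j ↦ h j i) h i j).const_mul _

theorem measurable_AICc (X : Matrix (Fin n) (Fin p) ℝ) :
    Measurable (AICc X : Sample n q → ℝ) := by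
  have hdet := measurable_matrix_det (measurable_Sigmahat_apply (q := q) X)
  have hinv := measurable_matrix_inv_apply (measurable_Sigmahat_apply (q := q) X)
  have hres : ∀ i j, Measurable fun Y : Sample n q ↦ (Y i - rowMean X (Bhat X Y) i) j := by
    intro i j
    simp only [PiLp.sub_apply, rowMean_apply]
    exact (measurable_dataMatrix_apply i j).sub (measurable_mul_Bhat_apply X i j)
  unfold AICc density gaussianDensity
  simp only [dotProduct, Matrix.mulVec]
  refine ((Measurable.log (Finset.measurable_prod _ fun i _ ↦ ?_)).const_mul _).add_const _
  refine ((hdet.pow_const _).const_mul _).mul (Measurable.exp (Measurable.const_mul ?_ _))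
  exact Finset.measurable_sum _ fun j _ ↦ (hres i j).mul
    (Finset.measurable_sum _ fun k _ ↦ (hinv j k).mul (hres i k))

theorem AICc_sub_AIC (hn : p + q + 1 < n) (X : Matrix (Fin n) (Fin p) ℝ) (Y : Sample n q) :
    AICc X Y - AIC X Y =
      2 * ((p : ℝ) + q + 1) / ((n : ℝ) - p - q - 1) * numParams p q := by
  have : (p : ℝ) + q + 1 < n := by exact_mod_cast hn
  have : (n : ℝ) - p - q - 1 ≠ 0 := by linarith
  rw [AICc, AIC]
  field_simp
  ring

end MVRegression

end

/-! ### Comparison of AIC and AICc. -/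

theorem mainTheorem3 (n p q : ℕ) (hq : 1 ≤ q) (hn : p + q + 1 < n)
    (X : Matrix (Fin n) (Fin p) ℝ) (hX : X.rank = p) :
    -- AICc and AIC differ by a constant
    (∀ Y : MVRegression.Sample n q,
      MVRegression.AICc X Y - MVRegression.AIC X Y =
        2 * ((p : ℝ) + q + 1) / ((n : ℝ) - p - q - 1) * MVRegression.numParams p q) ∧
    -- AICc is exactly unbiased
    (∀ θ : MVRegression.Param p q,
      Integrable (MVRegression.AICc X) (MVRegression.law X θ) ∧
      Integrable (MVRegression.klDiscrepancy X θ) (MVRegression.law X θ) ∧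
      ∫ Y, MVRegression.AICc X Y ∂(MVRegression.law X θ) =
        ∫ Y, MVRegression.klDiscrepancy X θ Y ∂(MVRegression.law X θ)) ∧
    -- the mean squared error (possibly infinite) of AICc never exceeds that of AIC
    (∀ θ : MVRegression.Param p q,
      LossEstimation.mse (MVRegression.law X) (MVRegression.klDiscrepancy X)
          (MVRegression.AICc X) θ ≤
        LossEstimation.mse (MVRegression.law X) (MVRegression.klDiscrepancy X)
          (MVRegression.AIC X) θ) ∧
    -- in the range where the mean squared errors are finite
    (p + q + 3 < n →
      -- the gap of the mean squared errors is the squared bias of AIC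
      (∀ θ : MVRegression.Param p q,
        Integrable (fun Y => (MVRegression.AIC X Y - MVRegression.klDiscrepancy X θ Y) ^ 2)
          (MVRegression.law X θ) ∧
        Integrable (fun Y => (MVRegression.AICc X Y - MVRegression.klDiscrepancy X θ Y) ^ 2)
          (MVRegression.law X θ) ∧
        ∫ Y, (MVRegression.AIC X Y - MVRegression.klDiscrepancy X θ Y) ^ 2
              ∂(MVRegression.law X θ) -
            ∫ Y, (MVRegression.AICc X Y - MVRegression.klDiscrepancy X θ Y) ^ 2
              ∂(MVRegression.law X θ) =
          (∫ Y, MVRegression.AIC X Y ∂(MVRegression.law X θ) -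
            ∫ Y, MVRegression.klDiscrepancy X θ Y ∂(MVRegression.law X θ)) ^ 2) ∧
      -- AIC is dominated by AICc
      LossEstimation.Dominates (MVRegression.law (q := q) X) (MVRegression.klDiscrepancy X)
        (MVRegression.AICc X) (MVRegression.AIC X) ∧
      -- AIC is inadmissible
      ¬ LossEstimation.Admissible (MVRegression.law (q := q) X) (MVRegression.klDiscrepancy X)
        (MVRegression.AIC X)) := by
  set c : ℝ := 2 * ((p : ℝ) + q + 1) / ((n : ℝ) - p - q - 1) * MVRegression.numParams p q with hc
  have hdiff := MVRegression.AICc_sub_AIC (q := q) hn X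
  have hAIC : ∀ (θ : MVRegression.Param p q) Y,
      MVRegression.AIC X Y - MVRegression.klDiscrepancy X θ Y =
        MVRegression.AICc X Y - MVRegression.klDiscrepancy X θ Y - c := fun θ Y ↦ by
    rw [hc, ← hdiff Y]
    ring
  -- Strictness uses q ≥ 1: for q = 0 there are no parameters and c = 0.
  have hcpos : 0 < c := by
    have h1 : (p : ℝ) + q + 1 < n := by exact_mod_cast hn
    have h2 : (0 : ℝ) < (n : ℝ) - p - q - 1 := by linarith
    have h3 : (0 : ℝ) < q := by exact_mod_cast hq
    rw [hc, MVRegression.numParams]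
    positivity
  have hint := fun θ : MVRegression.Param p q ↦
    MVRegression.integrable_AICc_sub_klDiscrepancy hX hn θ
  have hzero := fun θ : MVRegression.Param p q ↦
    MVRegression.integral_AICc_sub_klDiscrepancy hX hn θ
  have hA := fun θ : MVRegression.Param p q ↦ MVRegression.integrable_AICc hX hn θ
  have hd := fun θ : MVRegression.Param p q ↦ MVRegression.integrable_klDiscrepancy hX hn θ
  have hle : ∀ θ : MVRegression.Param p q,
      LossEstimation.mse (MVRegression.law X) (MVRegression.klDiscrepancy X)
          (MVRegression.AICc X) θ ≤
        LossEstimation.mse (MVRegression.law X) (MVRegression.klDiscrepancy X)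
          (MVRegression.AIC X) θ := by
    intro θ
    simp only [LossEstimation.mse, hAIC θ]
    exact LossEstimation.lintegral_sq_le_lintegral_sub_const_sq (hint θ) (hzero θ) c
  refine ⟨hdiff, fun θ ↦ ⟨hA θ, hd θ, ?_⟩, hle, fun hn3 ↦ ?_⟩
  · rw [← sub_eq_zero, ← integral_sub (hA θ) (hd θ)]
    exact hzero θ
  have hL2 := fun θ : MVRegression.Param p q ↦
    MVRegression.memLp_two_AICc_sub_klDiscrepancy hX hn3 θ
  have hL2' : ∀ θ : MVRegression.Param p q, MemLp (fun Y ↦ MVRegression.AICc X Y -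
      MVRegression.klDiscrepancy X θ Y - c) 2 (MVRegression.law X θ) :=
    fun θ ↦ (hL2 θ).sub (memLp_const c)
  have hdom : LossEstimation.Dominates (MVRegression.law (q := q) X)
      (MVRegression.klDiscrepancy X) (MVRegression.AICc X) (MVRegression.AIC X) := by
    -- Any parameter would do, since the gap c² is the same everywhere; B = 0, Σ = I is a convenient
    -- one.
    refine ⟨hle, (0, ⟨1, Matrix.PosDef.one⟩), ?_⟩
    simp only [LossEstimation.mse, hAIC]
    rw [LossEstimation.lintegral_sq_eq_ofReal (hL2 _),
      LossEstimation.lintegral_sq_eq_ofReal (hL2' _),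
      LossEstimation.integral_sub_const_sq (hL2 _) (hzero _)]
    have h0 : ∀ θ : MVRegression.Param p q, 0 ≤ ∫ Y, (MVRegression.AICc X Y -
        MVRegression.klDiscrepancy X θ Y) ^ 2 ∂(MVRegression.law X θ) :=
      fun θ ↦ integral_nonneg fun _ ↦ sq_nonneg _
    have hc2 : 0 < c ^ 2 := by positivity
    exact (ENNReal.ofReal_lt_ofReal_iff (add_pos_of_nonneg_of_pos (h0 _) hc2)).2
      (lt_add_of_pos_right _ hc2)
  refine ⟨fun θ ↦ ⟨?_, (hL2 θ).integrable_sq, ?_⟩, hdom, fun hadm ↦ hadm ⟨_, ?_, hdom⟩⟩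
  · simp only [hAIC θ]
    exact (hL2' θ).integrable_sq
  · have hAI : Integrable (MVRegression.AIC X) (MVRegression.law X θ) :=
      ((hA θ).sub (integrable_const c)).congr (.of_forall fun Y ↦ by
        simp only [Pi.sub_apply]
        rw [hc, ← hdiff Y]
        ring)
    rw [← integral_sub hAI (hd θ)]
    simp only [hAIC θ]
    rw [LossEstimation.integral_sub_const_sq (hL2 θ) (hzero θ),
      integral_sub (hint θ) (integrable_const c), hzero θ]
    simp
  · exact MVRegression.measurable_AICc X
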